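/- Let $d=2$, and let $\mathbb G=\{\mathcal G_i\}_{i\in I}$, $\mathcal G_i(X)=U_iXU_i^\dagger$, be a finite family of single-qubit unitary channels ($I\neq\emptyset$) forming a unitary 2-design, i.e. for every linear map $\Lambda$ on $2\times2$ matrices the twirl $\frac1{|I|}\sum_i \mathcal G_i\Lambda\mathcal G_i^\dagger$ has the form $X\mapsto aX+b\,\mathrm{tr}(X)\,\mathbb I$. Let $\tilde{\mathbb G}=\{\tilde{\mathcal G}_i\}_{i\in I}$ be a noisy gate-set, each $\tilde{\mathcal G}_i$ being a completely positive trace-preserving map. For a circuit length $m$ and a target gate-set $\mathbb H=\{\mathcal H_i\}_{i\in I}$ define the gate-set circuit fidelity $$\mathcal F(\tilde{\mathbb G},\mathbb H,m)=\frac1{|I|^m}\sum_{(i_1,\dots,i_m)\in I^m}\int \mathrm{tr}\Big[\big(\tilde{\mathcal G}_{i_m}\cdots\tilde{\mathcal G}_{i_1}(\psi)\big)^\dagger\,\mathcal H_{i_m}\cdots\mathcal H_{i_1}(\psi)\Big]\,d\psi ,$$ where $\psi$ is uniformly distributed over the pure states. Let $\mathcal T=\frac1{|I|}\sum_i (\boldsymbol{\mathcal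 G}_i\boldsymbol\Pi_{\rm tr})\otimes\tilde{\boldsymbol{\mathcal G}}_i$ be the twirling superchannel, where bold letters denote Liouville matrices in the normalized Pauli basis and $\Pi_{\rm tr}(X)=X-\mathrm{tr}(X)\,\mathbb I/d$. The RB decay parameter $p$ is the highest eigenvalue of $\mathcal T$: a real eigenvalue $p$ such that every eigenvalue of $\mathcal T$ has modulus at most $p$. There are absolute constants $\varepsilon,K>0$ such that for all such $\mathbb G,\tilde{\mathbb G}$ with $1-\mathcal F(\tilde{\mathbb G},\mathbb G,1)\le\varepsilon$, the RB decay parameter $p$ exists, and there is a unitary channel $\mathcal U(X)=VXV^\dagger$ such that for every circuit length $m\ge 0$ $$\left|\mathcal F(\tilde{\mathbb G},\mathcal U\mathbb G\mathcal U^\dagger,m)-\left(\frac1d+\frac{d-1}d\,p^m\right)\right|\le K(1-p)^2 ,$$ where $\mathcal U\mathbb G\mathcal U^\dagger=\{\mathcal U\mathcal G_i\mathcal U^\dagger\}_{i\in I}$. -/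

import Mathlib

open scoped Matrix Kronecker ComplexOrder
open MeasureTheory

namespace QubitRB

noncomputable section

/-- Operators on the Hilbert space `ℂ²` of one qubit (dimension `d = 2`). -/
abbrev Op : Type := Matrix (Fin 2) (Fin 2) ℂ

/-- Linear maps on qubit operators. The monoid structure is composition. -/
abbrev SuperOp : Type := Module.End ℂ Op

/-- The amplification `Φ ⊗ id` of `Φ` to operators on `ℂ² ⊗ ℂⁿ`. -/
def amplify (n : ℕ) (Φ : SuperOp) (X : Matrix (Fin 2 × Fin n) (Fin 2 × Fin n) ℂ) :
    Matrix (Fin 2 × Fin n) (Fin 2 × Fin n) ℂ :=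
  Matrix.of fun i j => Φ (Matrix.of fun k l => X (k, i.2) (l, j.2)) i.1 j.1

/-- A qubit channel: a completely positive, trace-preserving linear map. -/
structure IsChannel (Φ : SuperOp) : Prop where
  completelyPositive : ∀ (n : ℕ) (X : Matrix (Fin 2 × Fin n) (Fin 2 × Fin n) ℂ),
    X.PosSemidef → (amplify n Φ X).PosSemidef
  tracePreserving : ∀ X : Op, (Φ X).trace = X.trace

/-- The unitary channel `X ↦ u X u†`. Its adjoint is `unitaryChannel u⁻¹`. -/
def unitaryChannel (u : Matrix.unitaryGroup (Fin 2) ℂ) : SuperOp where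
  toFun X := (u : Op) * X * (u : Op)ᴴ
  map_add' X Y := by rw [mul_add, add_mul]
  map_smul' c X := by simp

/-- The pure state `|ψ⟩⟨ψ|` of a vector `ψ`. -/
def pureState (ψ : EuclideanSpace ℂ (Fin 2)) : Op :=
  Matrix.of fun i j => ψ i * star (ψ j)

/-- The Hilbert-Schmidt inner product `⟨M₁, M₂⟩ = tr (M₁† M₂)`. -/
def hsInner (M₁ M₂ : Op) : ℂ := (M₁ᴴ * M₂).trace

/-- Average fidelity of `Cn` to `C`: the mean of `⟨Cn(ψ), C(ψ)⟩` over pure states `ψ`, distributed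
uniformly on the unit sphere of `ℂ²`. (For channels the inner product is a real number.) -/
def avgFidelity (Cn C : SuperOp) : ℝ :=
  ⨍ ψ : Metric.sphere (0 : EuclideanSpace ℂ (Fin 2)) 1,
    (hsInner (Cn (pureState ψ)) (C (pureState ψ))).re
    ∂((volume : Measure (EuclideanSpace ℂ (Fin 2))).toSphere)

/-- The circuit `G_{s (m-1)} ∘ ⋯ ∘ G_{s 1} ∘ G_{s 0}`. -/
def circuit {ι : Type*} (G : ι → SuperOp) : (m : ℕ) → (Fin m → ι) → SuperOp
  | 0, _ => 1
  | m + 1, s => G (s (Fin.last m)) * circuit G m (fun k => s k.castSucc)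

/-- Gate-set circuit fidelity: the expected average fidelity of the noisy circuit to the target
circuit, over `m` independent uniformly random gate labels. -/
def gateSetFidelity {ι : Type*} [Fintype ι] (Gn G : ι → SuperOp) (m : ℕ) : ℝ :=
  (∑ s : Fin m → ι, avgFidelity (circuit Gn m s) (circuit G m s)) / (Fintype.card ι : ℝ) ^ m

/-- The ideal gate-set given by a family of unitaries. -/
def idealGates {ι : Type*} (u : ι → Matrix.unitaryGroup (Fin 2) ℂ) : ι → SuperOp :=
  fun i => unitaryChannel (u i)

/-- The rotated gate-set `𝒱 𝔾 𝒱†`. -/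
def rotate {ι : Type*} (v : Matrix.unitaryGroup (Fin 2) ℂ) (G : ι → SuperOp) : ι → SuperOp :=
  fun i => unitaryChannel v * G i * unitaryChannel v⁻¹

/-- Unitary 2-design: twirling any linear map `Λ` over the family gives a map
`X ↦ a X + b tr(X) 1`, that is (as `a`, `b` are fixed by the trace and by `tr Λ(1)`, which
twirling preserves), the same map as twirling `Λ` over the whole unitary group. -/
def IsTwoDesign {ι : Type*} [Fintype ι] (u : ι → Matrix.unitaryGroup (Fin 2) ℂ) : Prop :=
  ∀ Λ : SuperOp, ∃ a b : ℂ, ∀ X : Op,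
    (Fintype.card ι : ℂ)⁻¹ • ∑ i, (unitaryChannel (u i) * Λ * unitaryChannel (u i)⁻¹) X
      = a • X + (b * X.trace) • (1 : Op)

/-- The projector `X ↦ X - tr(X) 1 / d` onto the traceless operators. -/
def tracelessProj : SuperOp where
  toFun X := X - (X.trace / 2) • (1 : Op)
  map_add' X Y := by rw [Matrix.trace_add, add_div, add_smul]; abel
  map_smul' c X := by
    rw [Matrix.trace_smul, RingHom.id_apply, smul_sub, smul_smul, smul_eq_mul, mul_div_assoc]

/-- The Pauli matrices `1, X, Y, Z`. -/
def pauli : Fin 4 → Op :=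
  ![1, !![0, 1; 1, 0], !![0, -Complex.I; Complex.I, 0], !![1, 0; 0, -1]]

/-- The Liouville matrix of a linear map, in the orthonormal basis `pauli j / √2`. -/
def liouville (A : SuperOp) : Matrix (Fin 4) (Fin 4) ℂ :=
  Matrix.of fun j k => hsInner (pauli j) (A (pauli k)) / 2

/-- The twirling superchannel `𝓣 = 𝔼 [𝒢_tr ⊗ 𝒢̃]` with `𝒢_tr = 𝒢 Π_tr`. -/
def twirlingSuperchannel {ι : Type*} [Fintype ι] (Gn G : ι → SuperOp) :
    Matrix (Fin 4 × Fin 4) (Fin 4 × Fin 4) ℂ :=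
  (Fintype.card ι : ℂ)⁻¹ • ∑ i, liouville (G i * tracelessProj) ⊗ₖ liouville (Gn i)

/-- `p` is the RB decay parameter: the highest eigenvalue of the twirling superchannel, a real
number that is an eigenvalue and bounds the modulus of every eigenvalue (so it is unique). -/
def IsRBDecayParameter {ι : Type*} [Fintype ι] (Gn G : ι → SuperOp) (p : ℝ) : Prop :=
  (p : ℂ) ∈ spectrum ℂ (twirlingSuperchannel Gn G) ∧
    ∀ z ∈ spectrum ℂ (twirlingSuperchannel Gn G), ‖z‖ ≤ p

end

end QubitRB

/-!
In Bloch coordinates a positive trace-preserving map has as linear part a contraction `M i` of `ℝ³`,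
and an ideal gate is a rotation `R i`. The twirling superchannel becomes the averaged map
`T : X ↦ 𝔼 [M i * X * (R i)ᴴ]` on `3 × 3` matrices, and the fidelity at length `m` equals
`1 / 2 + tr (T ^ m 1) / 6`.

For noiseless gates the 2-design property makes `T` the projection `X ↦ (tr X / 3) • 1`. High
fidelity makes the noisy `T` a small perturbation of this projection, so it has a unique dominant
eigenvalue `p`, with an eigenvector `A` near `1`. Conjugating the ideal gates by a unitary `v`
replaces `A` by `A * (rotation v)ᴴ`. Choosing `v` to maximise the trace, as in the polar
decomposition, makes this matrix symmetric.

Rescale the aligned eigenvector to trace `3` and call it `A` again. Contractivity of the `M i`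
forces `‖A - 1‖ = O(1 - p)` because `A` is symmetric. Moreover `tr (T (A - 1))` is, up to sign, the
pairing of the traceless symmetric matrix `A - 1` with a positive matrix of trace `O(1 - p)`, hence
is `O((1 - p)²)`. It bounds `tr (T ^ m 1) / 3 - p ^ m` up to terms of the order of the square of the
perturbation times `‖A - 1‖`, again `O((1 - p)²)` uniformly in `m`.
-/

namespace QubitRB

section Perturbation

variable {𝕜 E : Type*} [NontriviallyNormedField 𝕜] [NormedAddCommGroup E] [NormedSpace 𝕜 E]

/-- `S` is within `δ` of the rank-one projection `x ↦ τ x • e`, where `τ` has norm at most `c` and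
`c ‖e‖ ≤ 1`, so that the projection has norm `1`. The bounds are stated pointwise because
matrices carry several norms, none of them a global instance. -/
structure IsNearProjection (S : Module.End 𝕜 E) (τ : Module.Dual 𝕜 E) (e : E) (c δ : ℝ) :
    Prop where
  apply_eq_one : τ e = 1
  norm_apply_le : ∀ x, ‖τ x‖ ≤ c * ‖x‖
  mul_norm_le_one : c * ‖e‖ ≤ 1
  norm_sub_smul_le : ∀ x, ‖S x - τ x • e‖ ≤ δ * ‖x‖

/-- The map whose fixed points `a` in the kernel of `τ` are the corrections for which `e + a` is an
eigenvector of `S`. -/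
def eigenvectorStep (S : Module.End 𝕜 E) (τ : Module.Dual 𝕜 E) (e a : E) : E :=
  (S - τ.smulRight e) (e + a) - τ ((S - τ.smulRight e) (e + a)) • (e + a)

theorem norm_add_correction_le {e a : E} {δ : ℝ} (hδ : δ ≤ 1 / 10) (ha : ‖a‖ ≤ 6 * δ * ‖e‖) :
    ‖e + a‖ ≤ 8 / 5 * ‖e‖ := by
  have h6 : 6 * δ * ‖e‖ ≤ 6 * (1 / 10) * ‖e‖ := by gcongr
  linarith [norm_add_le e a]

namespace IsNearProjection

variable {S : Module.End 𝕜 E} {τ : Module.Dual 𝕜 E} {e A : E} {p : 𝕜} {c δ : ℝ}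

theorem norm_vector_pos (h : IsNearProjection S τ e c δ) : 0 < ‖e‖ := by
  refine norm_pos_iff.2 fun he => ?_
  simpa [he] using h.apply_eq_one

theorem bound_nonneg (h : IsNearProjection S τ e c δ) : 0 ≤ c := by
  have he := (norm_nonneg _).trans (h.norm_apply_le e)
  exact nonneg_of_mul_nonneg_left he h.norm_vector_pos

theorem nonneg (h : IsNearProjection S τ e c δ) : 0 ≤ δ :=
  nonneg_of_mul_nonneg_left ((norm_nonneg _).trans (h.norm_sub_smul_le e)) h.norm_vector_pos

theorem norm_apply_of_mem_ker (h : IsNearProjection S τ e c δ) {y : E} (hy : τ y = 0) :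
    ‖S y‖ ≤ δ * ‖y‖ := by
  simpa [hy] using h.norm_sub_smul_le y

theorem norm_smulRight_sub_le (h : IsNearProjection S τ e c δ) (x : E) :
    ‖(S - τ.smulRight e) x‖ ≤ δ * ‖x‖ := by
  simpa using h.norm_sub_smul_le x

theorem norm_dual_smulRight_sub_le (h : IsNearProjection S τ e c δ) (x : E) :
    ‖τ ((S - τ.smulRight e) x)‖ ≤ c * (δ * ‖x‖) :=
  (h.norm_apply_le _).trans
    (mul_le_mul_of_nonneg_left (h.norm_smulRight_sub_le x) h.bound_nonneg)

theorem mul_norm_vector_add_le (h : IsNearProjection S τ e c δ) (hδ : δ ≤ 1 / 10) {a : E}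
    (ha : ‖a‖ ≤ 6 * δ * ‖e‖) : c * ‖e + a‖ ≤ 8 / 5 := by
  have hea := mul_le_mul_of_nonneg_left (norm_add_correction_le hδ ha) h.bound_nonneg
  linarith [h.mul_norm_le_one]

theorem norm_dual_smulRight_sub_vector_add_le (h : IsNearProjection S τ e c δ) (hδ : δ ≤ 1 / 10)
    {a : E} (ha : ‖a‖ ≤ 6 * δ * ‖e‖) : ‖τ ((S - τ.smulRight e) (e + a))‖ ≤ 8 / 5 * δ := by
  have hea := mul_le_mul_of_nonneg_left (h.mul_norm_vector_add_le hδ ha) h.nonneg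
  linarith [h.norm_dual_smulRight_sub_le (e + a)]

theorem mapsTo_eigenvectorStep (h : IsNearProjection S τ e c δ) (hδ : δ ≤ 1 / 10) :
    Set.MapsTo (eigenvectorStep S τ e) (Metric.closedBall 0 (6 * δ * ‖e‖))
      (Metric.closedBall 0 (6 * δ * ‖e‖)) := by
  intro a ha
  rw [mem_closedBall_zero_iff] at ha ⊢
  have hδ0 := h.nonneg
  calc ‖eigenvectorStep S τ e a‖
      ≤ ‖(S - τ.smulRight e) (e + a)‖ + ‖τ ((S - τ.smulRight e) (e + a)) • (e + a)‖ :=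
        norm_sub_le _ _
    _ ≤ δ * (8 / 5 * ‖e‖) + 8 / 5 * δ * (8 / 5 * ‖e‖) := by
        rw [norm_smul]
        gcongr
        · exact (h.norm_smulRight_sub_le _).trans (by gcongr; exact norm_add_correction_le hδ ha)
        · exact h.norm_dual_smulRight_sub_vector_add_le hδ ha
        · exact norm_add_correction_le hδ ha
    _ ≤ 6 * δ * ‖e‖ := by nlinarith [mul_nonneg hδ0 h.norm_vector_pos.le]

theorem norm_eigenvectorStep_sub_le (h : IsNearProjection S τ e c δ) (hδ : δ ≤ 1 / 10) {a b : E}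
    (ha : ‖a‖ ≤ 6 * δ * ‖e‖) (hb : ‖b‖ ≤ 6 * δ * ‖e‖) :
    ‖eigenvectorStep S τ e a - eigenvectorStep S τ e b‖ ≤ 1 / 2 * ‖a - b‖ := by
  set D := S - τ.smulRight e
  have hDab : D (a - b) = D (e + a) - D (e + b) := by rw [← map_sub, add_sub_add_left_eq_sub]
  have hsplit : eigenvectorStep S τ e a - eigenvectorStep S τ e b
      = D (a - b) - τ (D (a - b)) • (e + a) - τ (D (e + b)) • (a - b) := by
    rw [hDab, map_sub, eigenvectorStep, eigenvectorStep]
    module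
  have h1 : ‖D (a - b)‖ ≤ δ * ‖a - b‖ := h.norm_smulRight_sub_le _
  have h2 : ‖τ (D (a - b)) • (e + a)‖ ≤ 8 / 5 * (δ * ‖a - b‖) := by
    rw [norm_smul]
    calc ‖τ (D (a - b))‖ * ‖e + a‖ ≤ c * (δ * ‖a - b‖) * ‖e + a‖ := by
          gcongr
          exact h.norm_dual_smulRight_sub_le _
      _ = c * ‖e + a‖ * (δ * ‖a - b‖) := by ring
      _ ≤ 8 / 5 * (δ * ‖a - b‖) := by
          have := h.nonneg
          gcongr
          exact h.mul_norm_vector_add_le hδ ha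
  have h3 : ‖τ (D (e + b)) • (a - b)‖ ≤ 8 / 5 * δ * ‖a - b‖ := by
    rw [norm_smul]
    gcongr
    exact h.norm_dual_smulRight_sub_vector_add_le hδ hb
  rw [hsplit]
  nlinarith [norm_sub_le (D (a - b) - τ (D (a - b)) • (e + a)) (τ (D (e + b)) • (a - b)),
    norm_sub_le (D (a - b)) (τ (D (a - b)) • (e + a)), norm_nonneg (a - b)]

theorem exists_eigenvectorStep_eq_self [CompleteSpace E] (h : IsNearProjection S τ e c δ)
    (hδ : δ ≤ 1 / 10) : ∃ a, ‖a‖ ≤ 6 * δ * ‖e‖ ∧ eigenvectorStep S τ e a = a := by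
  have hmaps := h.mapsTo_eigenvectorStep hδ
  have hcontr : ContractingWith (1 / 2) (hmaps.restrict (eigenvectorStep S τ e) _ _) := by
    refine ⟨by rw [← NNReal.coe_lt_coe]; norm_num, LipschitzWith.of_dist_le_mul fun a b => ?_⟩
    rw [Subtype.dist_eq, Subtype.dist_eq, dist_eq_norm, dist_eq_norm]
    simpa using h.norm_eigenvectorStep_sub_le hδ (mem_closedBall_zero_iff.1 a.2)
      (mem_closedBall_zero_iff.1 b.2)
  have hradius : 0 ≤ 6 * δ * ‖e‖ :=
    mul_nonneg (mul_nonneg (by norm_num) h.nonneg) h.norm_vector_pos.le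
  obtain ⟨a, ha, hfix, -⟩ := hcontr.exists_fixedPoint' Metric.isClosed_closedBall.isComplete hmaps
    (Metric.mem_closedBall_self hradius) (edist_ne_top _ _)
  exact ⟨a, mem_closedBall_zero_iff.1 ha, hfix⟩

theorem exists_eigenvector [CompleteSpace E] (h : IsNearProjection S τ e c δ)
    (hδ : δ ≤ 1 / 10) :
    ∃ (p : 𝕜) (A : E), S A = p • A ∧ τ A = 1 ∧ ‖A - e‖ ≤ 6 * δ * ‖e‖ ∧ ‖p - 1‖ ≤ 2 * δ := by
  obtain ⟨a, ha, hfix⟩ := h.exists_eigenvectorStep_eq_self hδ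
  have htle := h.norm_dual_smulRight_sub_vector_add_le hδ ha
  rw [eigenvectorStep] at hfix
  set t := τ ((S - τ.smulRight e) (e + a)) with ht
  have hδ0 := h.nonneg
  have ht1 : 1 + t ≠ 0 := fun h0 => by
    rw [eq_neg_of_add_eq_zero_right h0, norm_neg, norm_one] at htle
    linarith
  have hta : τ a = 0 := by
    have hτ := congrArg τ hfix
    rw [map_sub, map_smul, map_add τ, h.apply_eq_one, ← ht, smul_eq_mul] at hτ
    exact (mul_eq_zero.1 (by linear_combination -hτ : (1 + t) * τ a = 0)).resolve_left ht1
  have hτA : τ (e + a) = 1 := by rw [map_add, h.apply_eq_one, hta, add_zero]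
  refine ⟨1 + t, e + a, ?_, hτA, by rwa [add_sub_cancel_left], ?_⟩
  · rw [LinearMap.sub_apply, LinearMap.smulRight_apply, hτA, one_smul] at hfix
    rw [sub_eq_iff_eq_add.1 (sub_eq_iff_eq_add.1 hfix)]
    module
  · rw [add_sub_cancel_left]
    linarith

theorem norm_deflation_le (h : IsNearProjection S τ e c δ) (hA : c * ‖A‖ ≤ 2) {y : E}
    (hy : τ y = 0) : ‖S y - τ (S y) • A‖ ≤ 3 * δ * ‖y‖ := by
  have hSy := h.norm_apply_of_mem_ker hy
  have hτ : ‖τ (S y) • A‖ ≤ 2 * ‖S y‖ := by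
    rw [norm_smul]
    calc ‖τ (S y)‖ * ‖A‖ ≤ c * ‖S y‖ * ‖A‖ := by gcongr; exact h.norm_apply_le _
      _ = c * ‖A‖ * ‖S y‖ := by ring
      _ ≤ 2 * ‖S y‖ := by gcongr
  linarith [norm_sub_le (S y) (τ (S y) • A)]

theorem norm_eigenvalue_le (h : IsNearProjection S τ e c δ) (hA : c * ‖A‖ ≤ 2)
    (hSA : S A = p • A) (hτA : τ A = 1) {z : 𝕜} {x : E} (hx : x ≠ 0) (hSx : S x = z • x) :
    ‖z‖ ≤ max ‖p‖ (3 * δ) := by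
  set y := x - τ x • A with hy
  have hτy : τ y = 0 := by simp [hy, hτA]
  have hSy : S y = z • x - (τ x * p) • A := by rw [hy, map_sub, map_smul, hSx, hSA, smul_smul]
  have hzy : S y - τ (S y) • A = z • y := by
    rw [hSy, map_sub, map_smul, map_smul, hτA, hy, smul_eq_mul, smul_eq_mul]
    module
  rcases eq_or_ne y 0 with hy0 | hy0
  · rw [hy0, map_zero, eq_comm, sub_eq_zero] at hSy
    have hxA : x = τ x • A := sub_eq_zero.1 (hy.symm.trans hy0)
    rw [mul_comm, mul_smul, ← hxA] at hSy
    exact le_max_of_le_left (smul_left_injective 𝕜 hx hSy ▸ le_rfl)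
  · have hle := h.norm_deflation_le hA hτy
    rw [hzy, norm_smul] at hle
    exact le_max_of_le_right (le_of_mul_le_mul_right hle (norm_pos_iff.2 hy0))

theorem dual_pow_succ_apply (hSA : S A = p • A) (hτA : τ A = 1) (m : ℕ) (y : E) :
    τ ((S ^ (m + 1)) y) = p ^ m * τ (S y) + τ ((S ^ m) (S y - τ (S y) • A)) := by
  have hA : (S ^ m) A = p ^ m • A := by
    induction m with
    | zero => simp
    | succ m ih => rw [pow_succ, Module.End.mul_apply, hSA, map_smul, ih, smul_smul, pow_succ']
  rw [pow_succ, Module.End.mul_apply, map_sub, map_sub, map_smul, map_smul, hA, map_smul, hτA,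
    smul_eq_mul, smul_eq_mul]
  ring

theorem norm_dual_pow_apply_le (h : IsNearProjection S τ e c δ) (hδ : 6 * δ ≤ 1)
    (hA : c * ‖A‖ ≤ 2) (hSA : S A = p • A) (hτA : τ A = 1) (hp : ‖p‖ ≤ 1) (m : ℕ) {y : E}
    (hy : τ y = 0) : ‖τ ((S ^ m) y)‖ ≤ 2 * c * δ * ‖y‖ := by
  have hc := h.bound_nonneg
  have hδ0 := h.nonneg
  induction m generalizing y with
  | zero =>
    rw [pow_zero, Module.End.one_apply, hy, norm_zero]
    positivity
  | succ m ih =>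
    rw [dual_pow_succ_apply hSA hτA]
    have hleading : ‖p ^ m * τ (S y)‖ ≤ c * (δ * ‖y‖) := by
      rw [norm_mul, norm_pow]
      refine (mul_le_of_le_one_left (norm_nonneg _) (pow_le_one₀ (norm_nonneg _) hp)).trans
        ((h.norm_apply_le _).trans ?_)
      gcongr
      exact h.norm_apply_of_mem_ker hy
    have hrest : ‖τ ((S ^ m) (S y - τ (S y) • A))‖ ≤ 2 * c * δ * (3 * δ * ‖y‖) :=
      (ih (by simp [hτA])).trans (by gcongr; exact h.norm_deflation_le hA hy)
    have hδ2 : (c * δ * ‖y‖) * (6 * δ) ≤ c * δ * ‖y‖ := mul_le_of_le_one_right (by positivity) hδ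
    linarith [norm_add_le (p ^ m * τ (S y)) (τ ((S ^ m) (S y - τ (S y) • A)))]

theorem norm_dual_pow_sub_le (h : IsNearProjection S τ e c δ) (hδ : 6 * δ ≤ 1)
    (hA : c * ‖A‖ ≤ 2) (hSA : S A = p • A) (hτA : τ A = 1) (hp : ‖p‖ ≤ 1) (m : ℕ) :
    ‖τ ((S ^ m) e) - p ^ m‖ ≤ ‖τ (S (A - e))‖ + 6 * c * δ ^ 2 * ‖A - e‖ := by
  have hc := h.bound_nonneg
  have hτe : τ (A - e) = 0 := by rw [map_sub, hτA, h.apply_eq_one, sub_self]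
  cases m with
  | zero =>
    rw [pow_zero, pow_zero, Module.End.one_apply, h.apply_eq_one, sub_self, norm_zero]
    positivity
  | succ m =>
    have hsplit : τ ((S ^ (m + 1)) e) - p ^ (m + 1) = -τ ((S ^ (m + 1)) (A - e)) := by
      rw [map_sub, map_sub, dual_pow_succ_apply hSA hτA m A, hSA, map_smul, hτA, smul_eq_mul,
        mul_one, sub_self, map_zero, map_zero]
      ring
    rw [hsplit, norm_neg, dual_pow_succ_apply hSA hτA]
    have hleading : ‖p ^ m * τ (S (A - e))‖ ≤ ‖τ (S (A - e))‖ := by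
      rw [norm_mul, norm_pow]
      exact mul_le_of_le_one_left (norm_nonneg _) (pow_le_one₀ (norm_nonneg _) hp)
    have hrest : ‖τ ((S ^ m) (S (A - e) - τ (S (A - e)) • A))‖
        ≤ 2 * c * δ * (3 * δ * ‖A - e‖) := by
      have hδ0 := h.nonneg
      refine (h.norm_dual_pow_apply_le hδ hA hSA hτA hp m (by simp [hτA])).trans ?_
      gcongr
      exact h.norm_deflation_le hA hτe
    linarith [norm_add_le (p ^ m * τ (S (A - e))) (τ ((S ^ m) (S (A - e) - τ (S (A - e)) • A)))]

end IsNearProjection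

end Perturbation

section FrobeniusNorm

open scoped Matrix.Norms.Frobenius

variable {𝕜 m n : Type*} [RCLike 𝕜] [Fintype m] [Fintype n]

theorem sq_norm_eq_sum (X : Matrix m n 𝕜) : ‖X‖ ^ 2 = ∑ i, ∑ j, ‖X i j‖ ^ 2 := by
  rw [Matrix.frobenius_norm_def, ← Real.sqrt_eq_rpow, Real.sq_sqrt (by positivity)]
  simp only [Real.rpow_ofNat]

theorem trace_conjTranspose_mul_self (X : Matrix m n 𝕜) :
    (Xᴴ * X).trace = ((‖X‖ ^ 2 : ℝ) : 𝕜) := by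
  rw [sq_norm_eq_sum, Finset.sum_comm]
  simp [Matrix.trace, Matrix.mul_apply, RCLike.conj_mul]

theorem trace_mul_conjTranspose_self (X : Matrix m n 𝕜) :
    (X * Xᴴ).trace = ((‖X‖ ^ 2 : ℝ) : 𝕜) := by
  rw [Matrix.trace_mul_comm, trace_conjTranspose_mul_self]

theorem norm_trace_conjTranspose_mul_le (X Y : Matrix m n 𝕜) :
    ‖(Xᴴ * Y).trace‖ ≤ ‖X‖ * ‖Y‖ := by
  have hcs := Finset.sum_mul_sq_le_sq_mul_sq (Finset.univ : Finset (m × n))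
    (fun x => ‖X x.1 x.2‖) (fun x => ‖Y x.1 x.2‖)
  simp only [Fintype.sum_prod_type, ← sq_norm_eq_sum, ← mul_pow] at hcs
  refine le_trans ?_ (le_of_sq_le_sq hcs (by positivity))
  rw [Finset.sum_comm]
  simp only [Matrix.trace, Matrix.diag_apply, Matrix.mul_apply, Matrix.conjTranspose_apply]
  refine norm_sum_le_of_le _ fun j _ => norm_sum_le_of_le _ fun i _ => ?_
  rw [norm_mul, norm_star]

theorem norm_vecMulVec_star_self (v : n → 𝕜) :
    ‖Matrix.vecMulVec v (star v)‖ = ∑ i, ‖v i‖ ^ 2 := by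
  rw [← pow_left_inj₀ (norm_nonneg _) (by positivity) two_ne_zero, sq_norm_eq_sum, sq,
    Finset.sum_mul_sum]
  simp only [Matrix.vecMulVec_apply, Pi.star_apply, norm_mul, norm_star, mul_pow]

theorem norm_le_trace_of_posSemidef {Q : Matrix n n 𝕜} (hQ : Q.PosSemidef) :
    ‖Q‖ ≤ RCLike.re Q.trace := by
  obtain ⟨k, v, rfl⟩ := Matrix.posSemidef_iff_eq_sum_vecMulVec.1 hQ
  rw [Matrix.trace_sum, map_sum]
  refine norm_sum_le_of_le _ fun i _ => ?_
  rw [norm_vecMulVec_star_self, Matrix.trace_vecMulVec, dotProduct, map_sum]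
  refine Finset.sum_le_sum fun j _ => ?_
  rw [Pi.star_apply, RCLike.star_def, RCLike.mul_conj, ← RCLike.ofReal_pow, RCLike.ofReal_re]

theorem sq_norm_sub (X Y : Matrix m n 𝕜) :
    ‖X - Y‖ ^ 2 = ‖X‖ ^ 2 + ‖Y‖ ^ 2 - 2 * RCLike.re (X * Yᴴ).trace := by
  have h := congrArg RCLike.re (trace_mul_conjTranspose_self (X - Y))
  have hre : RCLike.re (Y * Xᴴ).trace = RCLike.re (X * Yᴴ).trace := by
    rw [← RCLike.conj_re, starRingEnd_apply, ← Matrix.trace_conjTranspose,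
      Matrix.conjTranspose_mul, Matrix.conjTranspose_conjTranspose]
  rw [RCLike.ofReal_re, Matrix.conjTranspose_sub, Matrix.sub_mul, Matrix.mul_sub, Matrix.mul_sub,
    Matrix.trace_sub, Matrix.trace_sub, Matrix.trace_sub, trace_mul_conjTranspose_self,
    trace_mul_conjTranspose_self, map_sub, map_sub, map_sub, hre, RCLike.ofReal_re,
    RCLike.ofReal_re] at h
  linarith

variable [DecidableEq n]

theorem sq_norm_one : ‖(1 : Matrix n n 𝕜)‖ ^ 2 = Fintype.card n := by
  have h := trace_conjTranspose_mul_self (1 : Matrix n n 𝕜)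
  rw [Matrix.conjTranspose_one, one_mul, Matrix.trace_one] at h
  exact_mod_cast h.symm

theorem norm_trace_le (X : Matrix n n 𝕜) : ‖X.trace‖ ≤ √(Fintype.card n) * ‖X‖ := by
  rw [← sq_norm_one (𝕜 := 𝕜), Real.sqrt_sq (norm_nonneg _)]
  simpa using norm_trace_conjTranspose_mul_le 1 X

theorem sq_norm_of_conjTranspose_mul_self_eq_one {H : Matrix n n 𝕜} (hH : Hᴴ * H = 1) :
    ‖H‖ ^ 2 = Fintype.card n := by
  have h := trace_conjTranspose_mul_self H
  rw [hH, Matrix.trace_one] at h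
  exact_mod_cast h.symm

theorem norm_mul_conjTranspose_of_conjTranspose_mul_self_eq_one {H : Matrix n n 𝕜}
    (hH : Hᴴ * H = 1) (X : Matrix m n 𝕜) : ‖X * Hᴴ‖ = ‖X‖ := by
  rw [← pow_left_inj₀ (norm_nonneg _) (norm_nonneg _) two_ne_zero]
  have h := trace_mul_conjTranspose_self (X * Hᴴ)
  rw [Matrix.conjTranspose_mul, Matrix.conjTranspose_conjTranspose, Matrix.mul_assoc,
    ← Matrix.mul_assoc Hᴴ, hH, Matrix.one_mul, trace_mul_conjTranspose_self] at h
  exact_mod_cast h.symm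

end FrobeniusNorm

section Twirl

open scoped Matrix.Norms.Frobenius

variable {𝕜 n ι : Type*} [RCLike 𝕜] [Fintype n] [Fintype ι]

/-- The average over `i` of the maps `X ↦ Mᵢ X Hᵢ†`. -/
noncomputable def twirl (M H : ι → Matrix n n 𝕜) : Module.End 𝕜 (Matrix n n 𝕜) where
  toFun X := (Fintype.card ι : 𝕜)⁻¹ • ∑ i, M i * X * (H i)ᴴ
  map_add' X Y := by simp only [mul_add, add_mul, Finset.sum_add_distrib, smul_add]
  map_smul' c X := by
    simp only [mul_smul_comm, smul_mul_assoc, ← Finset.smul_sum, smul_comm c, RingHom.id_apply]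

theorem twirl_apply (M H : ι → Matrix n n 𝕜) (X : Matrix n n 𝕜) :
    twirl M H X = (Fintype.card ι : 𝕜)⁻¹ • ∑ i, M i * X * (H i)ᴴ := rfl

/-- The linear functional `X ↦ tr X / N` on `N × N` matrices. -/
noncomputable def normalizedTrace (𝕜 n : Type*) [RCLike 𝕜] [Fintype n] :
    Module.Dual 𝕜 (Matrix n n 𝕜) :=
  (Fintype.card n : 𝕜)⁻¹ • Matrix.traceLinearMap n 𝕜 𝕜

theorem normalizedTrace_apply (X : Matrix n n 𝕜) :
    normalizedTrace 𝕜 n X = (Fintype.card n : 𝕜)⁻¹ * X.trace := rfl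

theorem trace_eq_card_of_normalizedTrace_eq_one [Nonempty n] {A : Matrix n n 𝕜}
    (hA : normalizedTrace 𝕜 n A = 1) : A.trace = Fintype.card n := by
  rwa [normalizedTrace_apply, inv_mul_eq_one₀ (Nat.cast_ne_zero.2 Fintype.card_ne_zero),
    eq_comm] at hA

theorem posSemidef_average_sub [Nonempty ι] (Y : ι → Matrix n n 𝕜) :
    ((Fintype.card ι : 𝕜)⁻¹ • ∑ i, (Y i)ᴴ * Y i
      - ((Fintype.card ι : 𝕜)⁻¹ • ∑ i, Y i)ᴴ * ((Fintype.card ι : 𝕜)⁻¹ • ∑ i, Y i)).PosSemidef := by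
  have hc : (Fintype.card ι : 𝕜) ≠ 0 := Nat.cast_ne_zero.2 Fintype.card_ne_zero
  set Z := (Fintype.card ι : 𝕜)⁻¹ • ∑ i, Y i
  have hsum : ∑ i, Y i = (Fintype.card ι : 𝕜) • Z := (smul_inv_smul₀ hc _).symm
  have hsumH : ∑ i, (Y i)ᴴ = (Fintype.card ι : 𝕜) • Zᴴ := by
    rw [← Matrix.conjTranspose_sum, hsum, Matrix.conjTranspose_smul, star_natCast]
  have hvariance : (Fintype.card ι : 𝕜)⁻¹ • ∑ i, (Y i)ᴴ * Y i - Zᴴ * Z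
      = (Fintype.card ι : 𝕜)⁻¹ • ∑ i, (Y i - Z)ᴴ * (Y i - Z) := by
    simp only [Matrix.conjTranspose_sub, sub_mul, mul_sub, Finset.sum_sub_distrib,
      ← Finset.mul_sum, ← Finset.sum_mul, hsum, hsumH, Finset.sum_const, Finset.card_univ]
    rw [← Nat.cast_smul_eq_nsmul 𝕜]
    simp only [smul_sub, smul_mul_assoc, mul_smul_comm, inv_smul_smul₀ hc]
    abel
  rw [hvariance]
  exact (Matrix.posSemidef_sum _ fun i _ => Matrix.posSemidef_conjTranspose_mul_self _).smul
    (by positivity)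

theorem sq_norm_average_le [Nonempty ι] (Y : ι → Matrix n n 𝕜) :
    ‖(Fintype.card ι : 𝕜)⁻¹ • ∑ i, Y i‖ ^ 2 ≤ (Fintype.card ι : ℝ)⁻¹ * ∑ i, ‖Y i‖ ^ 2 := by
  have h := (RCLike.nonneg_iff.1 (posSemidef_average_sub Y).trace_nonneg).1
  rw [Matrix.trace_sub, Matrix.trace_smul, Matrix.trace_sum, trace_conjTranspose_mul_self] at h
  simp only [trace_conjTranspose_mul_self] at h
  rw [smul_eq_mul, ← RCLike.ofReal_natCast, ← RCLike.ofReal_inv, ← RCLike.ofReal_sum,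
    ← RCLike.ofReal_mul, ← RCLike.ofReal_sub, RCLike.ofReal_re] at h
  simpa only [RCLike.ofReal_inv, RCLike.ofReal_natCast] using sub_nonneg.1 h

variable [DecidableEq n]

theorem normalizedTrace_one [Nonempty n] : normalizedTrace 𝕜 n 1 = 1 := by
  rw [normalizedTrace_apply, Matrix.trace_one,
    inv_mul_cancel₀ (Nat.cast_ne_zero.2 Fintype.card_ne_zero)]

/-- The matrices `Hᵢ` are unitary, and averaging `X ↦ Hᵢ X Hᵢ†` projects onto the scalar
matrices: the analogue for rotations of Bloch vectors of the unitary 2-design property. -/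
structure IsDepolarizing (H : ι → Matrix n n 𝕜) : Prop where
  conjTranspose_mul_self : ∀ i, (H i)ᴴ * H i = 1
  twirl_self : ∀ X, twirl H H X = normalizedTrace 𝕜 n X • (1 : Matrix n n 𝕜)

theorem trace_twirl_self [Nonempty ι] {H : ι → Matrix n n 𝕜} (hH : ∀ i, (H i)ᴴ * H i = 1)
    (X : Matrix n n 𝕜) : (twirl H H X).trace = X.trace := by
  have hterm : ∀ i, (H i * X * (H i)ᴴ).trace = X.trace := fun i => by
    rw [Matrix.trace_mul_comm, ← mul_assoc, hH, one_mul]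
  simp only [twirl_apply, Matrix.trace_smul, Matrix.trace_sum, hterm, Finset.sum_const,
    Finset.card_univ, nsmul_eq_mul, smul_eq_mul]
  exact inv_mul_cancel_left₀ (Nat.cast_ne_zero.2 Fintype.card_ne_zero) _

theorem isDepolarizing_of_forall_exists_eq_smul_one [Nonempty ι] [Nonempty n]
    {H : ι → Matrix n n 𝕜} (hH : ∀ i, (H i)ᴴ * H i = 1)
    (h : ∀ X, ∃ a : 𝕜, twirl H H X = a • (1 : Matrix n n 𝕜)) : IsDepolarizing H where
  conjTranspose_mul_self := hH
  twirl_self X := by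
    obtain ⟨a, ha⟩ := h X
    have htrace := trace_twirl_self hH X
    rw [ha, Matrix.trace_smul, Matrix.trace_one, smul_eq_mul] at htrace
    rw [ha, normalizedTrace_apply, ← htrace, mul_comm a,
      inv_mul_cancel_left₀ (Nat.cast_ne_zero.2 Fintype.card_ne_zero)]

theorem twirl_conj (M H : ι → Matrix n n 𝕜) {V : Matrix n n 𝕜} (hV : Vᴴ * V = 1)
    (X : Matrix n n 𝕜) :
    twirl M (fun i => V * H i * Vᴴ) (X * Vᴴ) = twirl M H X * Vᴴ := by
  simp only [twirl_apply, Matrix.smul_mul, Finset.sum_mul, Matrix.conjTranspose_mul,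
    Matrix.conjTranspose_conjTranspose, mul_assoc]
  simp only [← mul_assoc Vᴴ V, hV, one_mul]

theorem IsDepolarizing.conj [Nonempty ι] [Nonempty n] {H : ι → Matrix n n 𝕜}
    (hH : IsDepolarizing H) {V : Matrix n n 𝕜} (hV : Vᴴ * V = 1) :
    IsDepolarizing fun i => V * H i * Vᴴ := by
  have hV' : V * Vᴴ = 1 := mul_eq_one_comm.1 hV
  refine isDepolarizing_of_forall_exists_eq_smul_one (fun i => ?_) fun X =>
    ⟨normalizedTrace 𝕜 n (Vᴴ * X * V), ?_⟩
  · simp only [Matrix.conjTranspose_mul, Matrix.conjTranspose_conjTranspose, mul_assoc]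
    rw [← mul_assoc Vᴴ V, hV, one_mul, ← mul_assoc (H i)ᴴ, hH.conjTranspose_mul_self, one_mul, hV']
  · have h : twirl (fun i => V * H i * Vᴴ) (fun i => V * H i * Vᴴ) X
        = V * twirl H H (Vᴴ * X * V) * Vᴴ := by
      simp only [twirl_apply, Matrix.smul_mul, Matrix.mul_smul, Finset.mul_sum, Finset.sum_mul,
        Matrix.conjTranspose_mul, Matrix.conjTranspose_conjTranspose, mul_assoc]
    rw [h, hH.twirl_self, mul_smul_comm, mul_one, smul_mul_assoc, hV']

theorem trace_twirl_one (M H : ι → Matrix n n 𝕜) :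
    (twirl M H 1).trace = (Fintype.card ι : 𝕜)⁻¹ * ∑ i, (M i * (H i)ᴴ).trace := by
  simp only [twirl_apply, mul_one, Matrix.trace_smul, Matrix.trace_sum, smul_eq_mul]

theorem average_sq_norm_sub_le [Nonempty ι] {M H : ι → Matrix n n 𝕜}
    (hM : ∀ i, ‖M i‖ ^ 2 ≤ Fintype.card n) (hH : IsDepolarizing H) :
    (Fintype.card ι : ℝ)⁻¹ * ∑ i, ‖M i - H i‖ ^ 2
      ≤ 2 * (Fintype.card n - RCLike.re (twirl M H 1).trace) := by
  have hterm : ∀ i, ‖M i - H i‖ ^ 2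
      ≤ 2 * (Fintype.card n - RCLike.re (M i * (H i)ᴴ).trace) := fun i => by
    rw [sq_norm_sub, sq_norm_of_conjTranspose_mul_self_eq_one (hH.conjTranspose_mul_self i)]
    linarith [hM i]
  have hre : RCLike.re (twirl M H 1).trace
      = (Fintype.card ι : ℝ)⁻¹ * ∑ i, RCLike.re (M i * (H i)ᴴ).trace := by
    rw [trace_twirl_one, ← RCLike.ofReal_natCast, ← RCLike.ofReal_inv, RCLike.re_ofReal_mul,
      map_sum]
  refine (mul_le_mul_of_nonneg_left (Finset.sum_le_sum fun i _ => hterm i) (by positivity)).trans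
    (le_of_eq ?_)
  rw [hre, ← Finset.mul_sum, Finset.sum_sub_distrib, Finset.sum_const, Finset.card_univ,
    nsmul_eq_mul]
  field_simp

theorem sq_norm_twirl_sub_le [Nonempty ι] {M H : ι → Matrix n n 𝕜}
    (hM : ∀ i, ‖M i‖ ^ 2 ≤ Fintype.card n) (hH : IsDepolarizing H) (X : Matrix n n 𝕜) :
    ‖twirl M H X - normalizedTrace 𝕜 n X • (1 : Matrix n n 𝕜)‖ ^ 2
      ≤ 2 * (Fintype.card n - RCLike.re (twirl M H 1).trace) * ‖X‖ ^ 2 := by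
  have hdiff : twirl M H X - normalizedTrace 𝕜 n X • (1 : Matrix n n 𝕜)
      = (Fintype.card ι : 𝕜)⁻¹ • ∑ i, (M i - H i) * X * (H i)ᴴ := by
    rw [← hH.twirl_self, twirl_apply, twirl_apply, ← smul_sub, ← Finset.sum_sub_distrib]
    simp only [sub_mul]
  have hterm : ∀ i, ‖(M i - H i) * X * (H i)ᴴ‖ ^ 2 ≤ ‖M i - H i‖ ^ 2 * ‖X‖ ^ 2 := fun i => by
    rw [norm_mul_conjTranspose_of_conjTranspose_mul_self_eq_one (hH.conjTranspose_mul_self i),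
      ← mul_pow]
    gcongr
    exact norm_mul_le _ _
  calc ‖twirl M H X - normalizedTrace 𝕜 n X • (1 : Matrix n n 𝕜)‖ ^ 2
      ≤ (Fintype.card ι : ℝ)⁻¹ * ∑ i, ‖(M i - H i) * X * (H i)ᴴ‖ ^ 2 := by
        rw [hdiff]
        exact sq_norm_average_le _
    _ ≤ (Fintype.card ι : ℝ)⁻¹ * ∑ i, ‖M i - H i‖ ^ 2 * ‖X‖ ^ 2 := by
        gcongr
        exact hterm _
    _ = ((Fintype.card ι : ℝ)⁻¹ * ∑ i, ‖M i - H i‖ ^ 2) * ‖X‖ ^ 2 := by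
        rw [← Finset.sum_mul, mul_assoc]
    _ ≤ 2 * (Fintype.card n - RCLike.re (twirl M H 1).trace) * ‖X‖ ^ 2 :=
        mul_le_mul_of_nonneg_right (average_sq_norm_sub_le hM hH) (by positivity)

theorem isNearProjection_twirl [Nonempty ι] [Nonempty n] {M H : ι → Matrix n n 𝕜}
    (hM : ∀ i, ‖M i‖ ^ 2 ≤ Fintype.card n) (hH : IsDepolarizing H) {δ : ℝ} (hδ0 : 0 ≤ δ)
    (hδ : 2 * (Fintype.card n - RCLike.re (twirl M H 1).trace) ≤ δ ^ 2) :
    IsNearProjection (twirl M H) (normalizedTrace 𝕜 n) 1 (√(Fintype.card n))⁻¹ δ where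
  apply_eq_one := normalizedTrace_one
  norm_apply_le X := by
    rw [normalizedTrace_apply, norm_mul, norm_inv, RCLike.norm_natCast,
      inv_mul_le_iff₀ (by positivity)]
    refine (norm_trace_le X).trans (le_of_eq ?_)
    rw [← mul_assoc]
    congr 1
    rw [← div_eq_mul_inv, Real.div_sqrt]
  mul_norm_le_one := by
    rw [← sq_norm_one (𝕜 := 𝕜), Real.sqrt_sq (norm_nonneg _)]
    exact inv_mul_le_one
  norm_sub_smul_le X := by
    refine le_of_sq_le_sq ((sq_norm_twirl_sub_le hM hH X).trans ?_) (by positivity)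
    rw [mul_pow]
    gcongr

theorem conjTranspose_mapMatrix_ofReal (X : Matrix n n ℝ) :
    (Complex.ofRealHom.mapMatrix X)ᴴ = Complex.ofRealHom.mapMatrix Xᴴ := by
  ext i j
  simp

theorem mapMatrix_ofReal_smul (c : ℝ) (X : Matrix n n ℝ) :
    Complex.ofRealHom.mapMatrix (c • X) = (c : ℂ) • Complex.ofRealHom.mapMatrix X := by
  ext i j
  simp

theorem twirl_mapMatrix_ofReal (M H : ι → Matrix n n ℝ) (X : Matrix n n ℝ) :
    twirl (fun i => Complex.ofRealHom.mapMatrix (M i)) (fun i => Complex.ofRealHom.mapMatrix (H i))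
      (Complex.ofRealHom.mapMatrix X) = Complex.ofRealHom.mapMatrix (twirl M H X) := by
  rw [twirl_apply, twirl_apply, mapMatrix_ofReal_smul, map_sum, Complex.ofReal_inv,
    Complex.ofReal_natCast]
  simp only [conjTranspose_mapMatrix_ofReal, map_mul]

theorem trace_mapMatrix_ofReal (X : Matrix n n ℝ) :
    (Complex.ofRealHom.mapMatrix X).trace = X.trace :=
  (AddMonoidHom.map_trace Complex.ofRealHom X).symm

theorem normalizedTrace_mapMatrix_ofReal (X : Matrix n n ℝ) :
    normalizedTrace ℂ n (Complex.ofRealHom.mapMatrix X) = normalizedTrace ℝ n X := by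
  rw [normalizedTrace_apply, normalizedTrace_apply, trace_mapMatrix_ofReal, Complex.ofReal_mul,
    Complex.ofReal_inv, Complex.ofReal_natCast]

theorem norm_mapMatrix_ofReal (X : Matrix n n ℝ) : ‖Complex.ofRealHom.mapMatrix X‖ = ‖X‖ :=
  Matrix.frobenius_norm_map_eq X _ Complex.norm_real

theorem mapMatrix_ofReal_add_I_smul (X : Matrix n n ℂ) :
    Complex.ofRealHom.mapMatrix (X.map Complex.re)
      + Complex.I • Complex.ofRealHom.mapMatrix (X.map Complex.im) = X := by
  ext i j
  simp [mul_comm Complex.I, Complex.re_add_im]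

theorem IsDepolarizing.mapMatrix_ofReal {H : ι → Matrix n n ℝ} (hH : IsDepolarizing H) :
    IsDepolarizing fun i => Complex.ofRealHom.mapMatrix (H i) where
  conjTranspose_mul_self i := by
    rw [conjTranspose_mapMatrix_ofReal, ← map_mul, hH.conjTranspose_mul_self, map_one]
  twirl_self X := by
    have hreal : ∀ Y : Matrix n n ℝ,
        Complex.ofRealHom.mapMatrix (normalizedTrace ℝ n Y • (1 : Matrix n n ℝ))
          = normalizedTrace ℂ n (Complex.ofRealHom.mapMatrix Y) • (1 : Matrix n n ℂ) := fun Y => by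
      rw [mapMatrix_ofReal_smul, map_one, normalizedTrace_mapMatrix_ofReal]
    rw [← mapMatrix_ofReal_add_I_smul X, map_add, map_smul, twirl_mapMatrix_ofReal,
      twirl_mapMatrix_ofReal, hH.twirl_self, hH.twirl_self, hreal, hreal, map_add, map_smul,
      add_smul, smul_assoc]

end Twirl

section Contraction

open scoped Matrix.Norms.Frobenius

variable {𝕜 n ι : Type*} [RCLike 𝕜] [Fintype n] [DecidableEq n] [Fintype ι]

/-- `M` does not increase the Euclidean length of vectors, stated as `M† M ≤ 1` in the Loewner
order. -/
def IsContraction (M : Matrix n n 𝕜) : Prop := (1 - Mᴴ * M).PosSemidef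

theorem IsContraction.sq_norm_le {M : Matrix n n 𝕜} (hM : IsContraction M) :
    ‖M‖ ^ 2 ≤ Fintype.card n := by
  have h := (RCLike.nonneg_iff.1 hM.trace_nonneg).1
  rw [Matrix.trace_sub, Matrix.trace_one, trace_conjTranspose_mul_self, map_sub,
    RCLike.natCast_re, RCLike.ofReal_re] at h
  linarith

variable {M H : ι → Matrix n n 𝕜}

theorem posSemidef_normalizedTrace_smul_one_sub [Nonempty ι] (hM : ∀ i, IsContraction (M i))
    (hH : IsDepolarizing H) (X : Matrix n n 𝕜) :
    (normalizedTrace 𝕜 n (Xᴴ * X) • (1 : Matrix n n 𝕜)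
      - (twirl M H X)ᴴ * twirl M H X).PosSemidef := by
  have hloss : ((Fintype.card ι : 𝕜)⁻¹ • ∑ i,
      (X * (H i)ᴴ)ᴴ * (1 - (M i)ᴴ * M i) * (X * (H i)ᴴ)).PosSemidef :=
    (Matrix.posSemidef_sum _ fun i _ => (hM i).conjTranspose_mul_mul_same _).smul (by positivity)
  have hsplit : (Fintype.card ι : 𝕜)⁻¹ • ∑ i,
      (X * (H i)ᴴ)ᴴ * (1 - (M i)ᴴ * M i) * (X * (H i)ᴴ)
        = normalizedTrace 𝕜 n (Xᴴ * X) • (1 : Matrix n n 𝕜)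
          - (Fintype.card ι : 𝕜)⁻¹ • ∑ i, (M i * X * (H i)ᴴ)ᴴ * (M i * X * (H i)ᴴ) := by
    rw [← hH.twirl_self, twirl_apply, ← smul_sub, ← Finset.sum_sub_distrib]
    simp only [Matrix.conjTranspose_mul, Matrix.conjTranspose_conjTranspose, mul_sub, sub_mul,
      mul_one, mul_assoc]
  have hvariance := posSemidef_average_sub fun i => M i * X * (H i)ᴴ
  rw [hsplit] at hloss
  simpa only [sub_add_sub_cancel, ← twirl_apply] using hloss.add hvariance

theorem norm_twirl_le [Nonempty ι] [Nonempty n] (hM : ∀ i, IsContraction (M i))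
    (hH : IsDepolarizing H) (X : Matrix n n 𝕜) : ‖twirl M H X‖ ≤ ‖X‖ := by
  have h := (posSemidef_normalizedTrace_smul_one_sub hM hH X).trace_nonneg
  rw [Matrix.trace_sub, Matrix.trace_smul, normalizedTrace_apply, Matrix.trace_one, smul_eq_mul,
    mul_right_comm, inv_mul_cancel₀ (Nat.cast_ne_zero.2 Fintype.card_ne_zero), one_mul,
    trace_conjTranspose_mul_self, trace_conjTranspose_mul_self, ← RCLike.ofReal_sub,
    RCLike.ofReal_nonneg, sub_nonneg] at h
  exact le_of_sq_le_sq h (norm_nonneg _)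

end Contraction

section SymmetricEigenvector

open scoped Matrix.Norms.Frobenius

variable {n ι : Type*} [Fintype n] [DecidableEq n] [Fintype ι] [Nonempty ι]
  {M H : ι → Matrix n n ℝ} {A : Matrix n n ℝ} {p : ℝ}

theorem le_one_of_twirl_eq_smul [Nonempty n] (hM : ∀ i, IsContraction (M i))
    (hH : IsDepolarizing H) (hA : twirl M H A = p • A) (hA0 : A ≠ 0) : p ≤ 1 := by
  have h := norm_twirl_le hM hH A
  rw [hA, norm_smul] at h
  exact (le_abs_self p).trans (le_of_mul_le_mul_right (by rwa [one_mul]) (norm_pos_iff.2 hA0))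

theorem sq_norm_eq_card_add [Nonempty n] (hA : normalizedTrace ℝ n A = 1) :
    ‖A‖ ^ 2 = Fintype.card n + ‖A - 1‖ ^ 2 := by
  rw [sq_norm_sub, sq_norm_one, Matrix.conjTranspose_one, mul_one,
    trace_eq_card_of_normalizedTrace_eq_one hA, RCLike.re_to_real]
  ring

theorem norm_sub_normalizedTrace_smul_one_le (X : Matrix n n ℝ) :
    ‖X - normalizedTrace ℝ n X • (1 : Matrix n n ℝ)‖ ≤ ‖X‖ := by
  refine le_of_sq_le_sq ?_ (norm_nonneg _)
  rw [sq_norm_sub, norm_smul, mul_pow, sq_norm_one, Matrix.conjTranspose_smul,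
    Matrix.conjTranspose_one, mul_smul_comm, mul_one, Matrix.trace_smul, normalizedTrace_apply]
  simp only [star_trivial, Real.norm_eq_abs, sq_abs, smul_eq_mul, RCLike.re_to_real]
  have hdefect : ((Fintype.card n : ℝ)⁻¹ * X.trace) ^ 2 * (Fintype.card n : ℝ)
    = (Fintype.card n : ℝ)⁻¹ * X.trace ^ 2 := by field_simp
  have hdefect_nonneg : 0 ≤ (Fintype.card n : ℝ)⁻¹ * X.trace ^ 2 := by positivity
  rw [hdefect]
  linarith

theorem two_mul_sq_mul_norm_sub_one_le [Nonempty n] (hM : ∀ i, IsContraction (M i))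
    (hH : IsDepolarizing H) (hA : twirl M H A = p • A) (hτ : normalizedTrace ℝ n A = 1)
    (hAs : A.IsHermitian) :
    2 * p ^ 2 * ‖A - 1‖ ≤ Fintype.card n * (1 - p ^ 2) + ‖A - 1‖ ^ 2 := by
  have hZ := posSemidef_normalizedTrace_smul_one_sub hM hH A
  rw [hA, hAs.eq, Matrix.conjTranspose_smul, star_trivial, hAs.eq, smul_mul_smul_comm,
    ← sq p] at hZ
  set Z := normalizedTrace ℝ n (A * A) • (1 : Matrix n n ℝ) - p ^ 2 • (A * A) with hZdef
  have hZtr : Z.trace = ‖A‖ ^ 2 * (1 - p ^ 2) := by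
    have h := trace_conjTranspose_mul_self A
    rw [hAs.eq] at h
    rw [hZdef, Matrix.trace_sub, Matrix.trace_smul, Matrix.trace_smul, normalizedTrace_apply, h,
      Matrix.trace_one, smul_eq_mul, smul_eq_mul, RCLike.ofReal_real_eq_id, id]
    field_simp
  have hZn : ‖Z‖ ≤ ‖A‖ ^ 2 * (1 - p ^ 2) := hZtr ▸ norm_le_trace_of_posSemidef hZ
  -- Only the traceless part of `Z` sees the term of `A² = (1 + (A - 1))²` linear in `A - 1`.
  have htraceless : (2 * p ^ 2) • (A - 1)
      = -(Z - normalizedTrace ℝ n Z • (1 : Matrix n n ℝ))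
        - p ^ 2 • ((A - 1) * (A - 1) - normalizedTrace ℝ n ((A - 1) * (A - 1)) • 1) := by
    simp only [hZdef, mul_sub, sub_mul, mul_one, one_mul, map_sub, map_smul, hτ,
      normalizedTrace_one, smul_eq_mul]
    module
  calc 2 * p ^ 2 * ‖A - 1‖ = ‖(2 * p ^ 2) • (A - 1)‖ := by
        rw [norm_smul, Real.norm_of_nonneg (by positivity)]
    _ ≤ ‖Z‖ + p ^ 2 * ‖A - 1‖ ^ 2 := by
        rw [htraceless]
        refine (norm_sub_le _ _).trans (add_le_add ?_ ?_)
        · rw [norm_neg]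
          exact norm_sub_normalizedTrace_smul_one_le Z
        · rw [norm_smul, Real.norm_of_nonneg (by positivity), sq ‖A - 1‖]
          gcongr
          exact (norm_sub_normalizedTrace_smul_one_le _).trans (norm_mul_le _ _)
    _ ≤ ‖A‖ ^ 2 * (1 - p ^ 2) + p ^ 2 * ‖A - 1‖ ^ 2 := by gcongr
    _ = Fintype.card n * (1 - p ^ 2) + ‖A - 1‖ ^ 2 := by rw [sq_norm_eq_card_add hτ]; ring

theorem norm_sub_one_le_of_isHermitian [Nonempty n] (hM : ∀ i, IsContraction (M i))
    (hH : IsDepolarizing H) (hA : twirl M H A = p • A) (hτ : normalizedTrace ℝ n A = 1)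
    (hAs : A.IsHermitian) (hA1 : ‖A - 1‖ ≤ 1 / 2) (hp : 9 / 10 ≤ p) :
    ‖A - 1‖ ≤ 2 * Fintype.card n * (1 - p) := by
  have hmain := two_mul_sq_mul_norm_sub_one_le hM hH hA hτ hAs
  have hp2 : 81 / 100 * ‖A - 1‖ ≤ p ^ 2 * ‖A - 1‖ := by
    gcongr
    nlinarith
  have hsq : ‖A - 1‖ ^ 2 ≤ 1 / 2 * ‖A - 1‖ := by
    rw [sq]
    gcongr
  have hcard : Fintype.card n * (1 - p ^ 2) ≤ Fintype.card n * (2 * (1 - p)) := by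
    gcongr
    nlinarith [sq_nonneg (1 - p)]
  linarith [norm_nonneg (A - 1)]

/-- The symmetric part of `1 - 𝔼 [Hᵢ† Mᵢ]`, whose trace measures the infidelity of the family
`M` to the family `H`. -/
noncomputable def infidelityMatrix (M H : ι → Matrix n n ℝ) : Matrix n n ℝ :=
  (Fintype.card ι : ℝ)⁻¹ • ∑ i, (1 - (1 / 2 : ℝ) • ((H i)ᴴ * M i + (M i)ᴴ * H i))

theorem posSemidef_infidelityMatrix (hM : ∀ i, IsContraction (M i))
    (hH : ∀ i, (H i)ᴴ * H i = 1) : (infidelityMatrix M H).PosSemidef := by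
  refine (Matrix.posSemidef_sum _ fun i _ => ?_).smul (by positivity)
  have hsplit : 1 - (1 / 2 : ℝ) • ((H i)ᴴ * M i + (M i)ᴴ * H i)
      = (1 / 2 : ℝ) • ((H i - M i)ᴴ * (H i - M i) + (1 - (M i)ᴴ * M i)) := by
    rw [Matrix.conjTranspose_sub, sub_mul, mul_sub, mul_sub, hH i]
    module
  rw [hsplit]
  exact ((Matrix.posSemidef_conjTranspose_mul_self _).add (hM i)).smul (by norm_num)

theorem trace_infidelityMatrix_mul {X : Matrix n n ℝ} (hX : X.IsHermitian) :
    (infidelityMatrix M H * X).trace = X.trace - (twirl M H X).trace := by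
  have hterm : ∀ i, ((1 - (1 / 2 : ℝ) • ((H i)ᴴ * M i + (M i)ᴴ * H i)) * X).trace
      = X.trace - (M i * X * (H i)ᴴ).trace := fun i => by
    have hsymm : ((M i)ᴴ * H i * X).trace = ((H i)ᴴ * M i * X).trace := by
      rw [← star_trivial ((M i)ᴴ * H i * X).trace, ← Matrix.trace_conjTranspose,
        Matrix.conjTranspose_mul, Matrix.conjTranspose_mul, Matrix.conjTranspose_conjTranspose,
        hX.eq, Matrix.trace_mul_comm]
    rw [sub_mul, one_mul, smul_mul_assoc, add_mul, Matrix.trace_sub, Matrix.trace_smul,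
      Matrix.trace_add, hsymm, Matrix.trace_mul_comm _ (H i)ᴴ, mul_assoc, smul_eq_mul]
    ring
  have hc : (Fintype.card ι : ℝ) ≠ 0 := Nat.cast_ne_zero.2 Fintype.card_ne_zero
  rw [infidelityMatrix, twirl_apply, smul_mul_assoc, Finset.sum_mul, Matrix.trace_smul,
    Matrix.trace_sum, Finset.sum_congr rfl fun i _ => hterm i, Finset.sum_sub_distrib,
    Finset.sum_const, Finset.card_univ, nsmul_eq_mul, Matrix.trace_smul, Matrix.trace_sum,
    smul_sub, smul_eq_mul, inv_mul_cancel_left₀ hc]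

theorem abs_trace_twirl_le (hM : ∀ i, IsContraction (M i)) (hH : ∀ i, (H i)ᴴ * H i = 1)
    {X : Matrix n n ℝ} (hX : X.IsHermitian) (hX0 : X.trace = 0) :
    |(twirl M H X).trace| ≤ (Fintype.card n - (twirl M H 1).trace) * ‖X‖ := by
  have hQ := posSemidef_infidelityMatrix hM hH
  have htr := trace_infidelityMatrix_mul (M := M) (H := H) (X := 1) Matrix.isHermitian_one
  rw [mul_one, Matrix.trace_one] at htr
  have hX' := trace_infidelityMatrix_mul (M := M) (H := H) hX
  rw [hX0, zero_sub] at hX'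
  have hcauchy := norm_trace_conjTranspose_mul_le (infidelityMatrix M H) X
  rw [hQ.isHermitian.eq, hX', norm_neg, Real.norm_eq_abs] at hcauchy
  rw [← htr]
  refine hcauchy.trans ?_
  gcongr
  exact norm_le_trace_of_posSemidef hQ

theorem abs_trace_twirl_sub_one_le [Nonempty n] (hM : ∀ i, IsContraction (M i))
    (hH : ∀ i, (H i)ᴴ * H i = 1) (hτ : normalizedTrace ℝ n A = 1) (hAs : A.IsHermitian) :
    |(twirl M H (A - 1)).trace| ≤ (Fintype.card n - (twirl M H 1).trace) * ‖A - 1‖ :=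
  abs_trace_twirl_le hM hH (hAs.sub Matrix.isHermitian_one) (by
    rw [Matrix.trace_sub, Matrix.trace_one, trace_eq_card_of_normalizedTrace_eq_one hτ, sub_self])

theorem card_sub_trace_twirl_one_le [Nonempty n] (hM : ∀ i, IsContraction (M i))
    (hH : ∀ i, (H i)ᴴ * H i = 1) (hA : twirl M H A = p • A) (hτ : normalizedTrace ℝ n A = 1)
    (hAs : A.IsHermitian) (hA1 : ‖A - 1‖ ≤ 1 / 2) :
    Fintype.card n - (twirl M H 1).trace ≤ 2 * Fintype.card n * (1 - p) := by
  have hq : 0 ≤ Fintype.card n - (twirl M H 1).trace := by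
    have h := (posSemidef_infidelityMatrix hM hH).trace_nonneg
    rwa [← mul_one (infidelityMatrix M H), trace_infidelityMatrix_mul Matrix.isHermitian_one,
      Matrix.trace_one] at h
  have hsplit : (twirl M H 1).trace + (twirl M H (A - 1)).trace = p * Fintype.card n := by
    rw [← Matrix.trace_add, ← map_add, add_sub_cancel, hA, Matrix.trace_smul,
      trace_eq_card_of_normalizedTrace_eq_one hτ, smul_eq_mul]
  have hcorrection := (le_abs_self _).trans (abs_trace_twirl_sub_one_le hM hH hτ hAs)
  have hhalf := mul_le_mul_of_nonneg_left hA1 hq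
  linarith

theorem abs_normalizedTrace_twirl_sub_one_le [Nonempty n] (hM : ∀ i, IsContraction (M i))
    (hH : IsDepolarizing H) (hA : twirl M H A = p • A) (hτ : normalizedTrace ℝ n A = 1)
    (hAs : A.IsHermitian) (hA1 : ‖A - 1‖ ≤ 1 / 2) (hp : 9 / 10 ≤ p) (hp1 : p ≤ 1) :
    |normalizedTrace ℝ n (twirl M H (A - 1))| ≤ 4 * Fintype.card n * (1 - p) ^ 2 := by
  have hN : (0 : ℝ) < Fintype.card n := Nat.cast_pos.2 Fintype.card_pos
  rw [normalizedTrace_apply, abs_mul, abs_of_pos (inv_pos.2 hN), inv_mul_le_iff₀ hN]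
  calc |(twirl M H (A - 1)).trace|
      ≤ (Fintype.card n - (twirl M H 1).trace) * ‖A - 1‖ :=
        abs_trace_twirl_sub_one_le hM hH.conjTranspose_mul_self hτ hAs
    _ ≤ 2 * Fintype.card n * (1 - p) * (2 * Fintype.card n * (1 - p)) :=
        mul_le_mul (card_sub_trace_twirl_one_le hM hH.conjTranspose_mul_self hA hτ hAs hA1)
          (norm_sub_one_le_of_isHermitian hM hH hA hτ hAs hA1 hp) (norm_nonneg _)
          (by have := sub_nonneg.2 hp1; positivity)
    _ = Fintype.card n * (4 * Fintype.card n * (1 - p) ^ 2) := by ring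

theorem abs_normalizedTrace_twirl_pow_sub_le [Nonempty n] (hM : ∀ i, IsContraction (M i))
    (hH : IsDepolarizing H) (hA : twirl M H A = p • A) (hτ : normalizedTrace ℝ n A = 1)
    (hAs : A.IsHermitian) (hA1 : ‖A - 1‖ ≤ 1 / 2) (hp : 144 * Fintype.card n * (1 - p) ≤ 1)
    (m : ℕ) :
    |normalizedTrace ℝ n ((twirl M H ^ m) 1) - p ^ m| ≤ 52 * Fintype.card n ^ 2 * (1 - p) ^ 2 := by
  have hN : (1 : ℝ) ≤ Fintype.card n := Nat.one_le_cast.2 Fintype.card_pos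
  have hA0 : A ≠ 0 := by rintro rfl; simp only [map_zero, zero_ne_one] at hτ
  have hp1 := le_one_of_twirl_eq_smul hM hH hA hA0
  have hp9 : 9 / 10 ≤ p := by nlinarith
  have hr : 0 ≤ 4 * Fintype.card n * (1 - p) := by have := sub_nonneg.2 hp1; positivity
  set δ := √(4 * Fintype.card n * (1 - p))
  have hδ : δ ^ 2 = 4 * Fintype.card n * (1 - p) := Real.sq_sqrt hr
  have hq := card_sub_trace_twirl_one_le hM hH.conjTranspose_mul_self hA hτ hAs hA1
  have hnear := isNearProjection_twirl (fun i => (hM i).sq_norm_le) hH (Real.sqrt_nonneg _)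
    (δ := δ) (by rw [hδ, RCLike.re_to_real]; linarith)
  have hc : (√(Fintype.card n : ℝ))⁻¹ ≤ 1 := inv_le_one_of_one_le₀ (Real.one_le_sqrt.2 hN)
  have ha := norm_sub_one_le_of_isHermitian hM hH hA hτ hAs hA1 hp9
  have hcA : (√(Fintype.card n : ℝ))⁻¹ * ‖A‖ ≤ 2 := by
    have h1 := hnear.mul_norm_le_one
    have h2 := norm_le_norm_add_norm_sub' A 1
    nlinarith [inv_nonneg.2 (Real.sqrt_nonneg (Fintype.card n : ℝ)), norm_nonneg (A - 1)]
  refine (hnear.norm_dual_pow_sub_le (by nlinarith) hcA hA hτ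
    (by rwa [Real.norm_of_nonneg (by linarith)]) m).trans ?_
  calc ‖normalizedTrace ℝ n (twirl M H (A - 1))‖ + 6 * (√(Fintype.card n))⁻¹ * δ ^ 2 * ‖A - 1‖
      ≤ 4 * Fintype.card n * (1 - p) ^ 2
        + 6 * 1 * (4 * Fintype.card n * (1 - p)) * (2 * Fintype.card n * (1 - p)) := by
        rw [← hδ]
        gcongr
        exact abs_normalizedTrace_twirl_sub_one_le hM hH hA hτ hAs hA1 hp9 hp1
    _ = 4 * Fintype.card n * (1 - p) ^ 2 + 48 * Fintype.card n ^ 2 * (1 - p) ^ 2 := by ring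
    _ ≤ 4 * Fintype.card n ^ 2 * (1 - p) ^ 2 + 48 * Fintype.card n ^ 2 * (1 - p) ^ 2 := by
        gcongr
        exact le_self_pow₀ hN two_ne_zero
    _ = 52 * Fintype.card n ^ 2 * (1 - p) ^ 2 := by ring

end SymmetricEigenvector

section AlignedEigenvector

open scoped Matrix.Norms.Frobenius

variable {n ι : Type*} [Fintype n] [DecidableEq n] [Nonempty n] [Fintype ι] [Nonempty ι]
  {M H : ι → Matrix n n ℝ} {A B : Matrix n n ℝ} {p : ℝ}

theorem norm_inv_normalizedTrace_smul_sub_one_le (hA : normalizedTrace ℝ n A = 1)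
    (hBA : ‖B‖ = ‖A‖) (htr : A.trace ≤ B.trace) :
    ‖(normalizedTrace ℝ n B)⁻¹ • B - 1‖ ≤ ‖A - 1‖ := by
  set t := normalizedTrace ℝ n B with ht
  have h1t : 1 ≤ t := by
    rw [← hA, ht, normalizedTrace_apply, normalizedTrace_apply]
    gcongr
  have hcenter : B - t • (1 : Matrix n n ℝ)
      = B - 1 - normalizedTrace ℝ n (B - 1) • (1 : Matrix n n ℝ) := by
    rw [map_sub, normalizedTrace_one, ← ht]
    module
  calc ‖t⁻¹ • B - 1‖ = ‖t⁻¹ • (B - t • (1 : Matrix n n ℝ))‖ := by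
        rw [smul_sub, inv_smul_smul₀ (by positivity)]
    _ ≤ 1 * ‖B - t • (1 : Matrix n n ℝ)‖ := by
        rw [norm_smul, Real.norm_of_nonneg (by positivity)]
        gcongr
        exact inv_le_one_of_one_le₀ h1t
    _ ≤ ‖B - 1‖ := by
        rw [one_mul, hcenter]
        exact norm_sub_normalizedTrace_smul_one_le _
    _ ≤ ‖A - 1‖ := by
        refine le_of_sq_le_sq ?_ (norm_nonneg _)
        rw [sq_norm_sub, sq_norm_sub, hBA, Matrix.conjTranspose_one, mul_one, mul_one]
        simp only [RCLike.re_to_real]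
        linarith

theorem abs_normalizedTrace_twirl_conj_pow_sub_le (hM : ∀ i, IsContraction (M i))
    (hH : IsDepolarizing H) (hA : twirl M H A = p • A) (hτ : normalizedTrace ℝ n A = 1)
    (hA1 : ‖A - 1‖ ≤ 1 / 2) (hp : 144 * Fintype.card n * (1 - p) ≤ 1) {V : Matrix n n ℝ}
    (hV : Vᴴ * V = 1) (hAV : (A * Vᴴ).IsHermitian) (htr : A.trace ≤ (A * Vᴴ).trace) (m : ℕ) :
    |normalizedTrace ℝ n ((twirl M (fun i => V * H i * Vᴴ) ^ m) 1) - p ^ m|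
      ≤ 52 * Fintype.card n ^ 2 * (1 - p) ^ 2 := by
  have hBA := norm_mul_conjTranspose_of_conjTranspose_mul_self_eq_one hV A
  have ht : normalizedTrace ℝ n (A * Vᴴ) ≠ 0 := by
    have h : normalizedTrace ℝ n A ≤ normalizedTrace ℝ n (A * Vᴴ) := by
      rw [normalizedTrace_apply, normalizedTrace_apply]
      gcongr
    linarith
  refine abs_normalizedTrace_twirl_pow_sub_le
    (A := (normalizedTrace ℝ n (A * Vᴴ))⁻¹ • (A * Vᴴ)) hM (hH.conj hV) ?_ ?_
    (hAV.smul (IsSelfAdjoint.all _))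
    ((norm_inv_normalizedTrace_smul_sub_one_le hτ hBA htr).trans hA1) hp m
  · rw [map_smul, twirl_conj M H hV, hA, smul_mul_assoc, smul_comm]
  · rw [map_smul, smul_eq_mul, inv_mul_cancel₀ ht]

theorem norm_eigenvalue_twirl_mapMatrix_ofReal_le (hM : ∀ i, IsContraction (M i))
    (hH : IsDepolarizing H) {δ : ℝ} (hδ0 : 0 ≤ δ)
    (hδ : 2 * (Fintype.card n - (twirl M H 1).trace) ≤ δ ^ 2) (hA : twirl M H A = p • A)
    (hτ : normalizedTrace ℝ n A = 1) (hA2 : ‖A‖ ≤ 2 * √(Fintype.card n)) {z : ℂ}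
    {W : Matrix n n ℂ} (hW0 : W ≠ 0)
    (hW : twirl (fun i => Complex.ofRealHom.mapMatrix (M i))
      (fun i => Complex.ofRealHom.mapMatrix (H i)) W = z • W) :
    ‖z‖ ≤ max |p| (3 * δ) := by
  have htrace : (twirl (fun i => Complex.ofRealHom.mapMatrix (M i))
      (fun i => Complex.ofRealHom.mapMatrix (H i)) 1).trace = (twirl M H 1).trace := by
    rw [← map_one Complex.ofRealHom.mapMatrix, twirl_mapMatrix_ofReal, trace_mapMatrix_ofReal]
  have hnear := isNearProjection_twirl (M := fun i => Complex.ofRealHom.mapMatrix (M i))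
    (fun i => by rw [norm_mapMatrix_ofReal]; exact (hM i).sq_norm_le) hH.mapMatrix_ofReal hδ0
    (by rwa [htrace])
  have hcA : (√(Fintype.card n))⁻¹ * ‖Complex.ofRealHom.mapMatrix A‖ ≤ 2 := by
    rwa [norm_mapMatrix_ofReal, inv_mul_le_iff₀ (by positivity), mul_comm]
  have hA' : twirl (fun i => Complex.ofRealHom.mapMatrix (M i))
      (fun i => Complex.ofRealHom.mapMatrix (H i)) (Complex.ofRealHom.mapMatrix A)
        = (p : ℂ) • Complex.ofRealHom.mapMatrix A := by
    rw [twirl_mapMatrix_ofReal, hA, mapMatrix_ofReal_smul]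
  have hτ' : normalizedTrace ℂ n (Complex.ofRealHom.mapMatrix A) = 1 := by
    rw [normalizedTrace_mapMatrix_ofReal, hτ, Complex.ofReal_one]
  have h := hnear.norm_eigenvalue_le hcA hA' hτ' hW0 hW
  rwa [Complex.norm_real, Real.norm_eq_abs] at h

theorem exists_dominant_eigenpair_twirl (hM : ∀ i, IsContraction (M i)) (hH : IsDepolarizing H)
    {δ : ℝ} (hδ0 : 0 ≤ δ) (hδ1 : δ ≤ 1 / 10)
    (hδ : 2 * (Fintype.card n - (twirl M H 1).trace) ≤ δ ^ 2) :
    ∃ (p : ℝ) (A : Matrix n n ℝ), twirl M H A = p • A ∧ normalizedTrace ℝ n A = 1 ∧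
      ‖A - 1‖ ≤ 6 * δ * √(Fintype.card n) ∧ |p - 1| ≤ 2 * δ ∧
      ∀ (z : ℂ) (W : Matrix n n ℂ), W ≠ 0 →
        twirl (fun i => Complex.ofRealHom.mapMatrix (M i))
          (fun i => Complex.ofRealHom.mapMatrix (H i)) W = z • W → ‖z‖ ≤ p := by
  have hone : ‖(1 : Matrix n n ℝ)‖ = √(Fintype.card n) := by
    rw [← sq_norm_one (𝕜 := ℝ), Real.sqrt_sq (norm_nonneg _)]
  obtain ⟨p, A, hA, hτ, hA1, hp⟩ := (isNearProjection_twirl (fun i => (hM i).sq_norm_le) hH hδ0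
    (by rwa [RCLike.re_to_real])).exists_eigenvector hδ1
  rw [hone] at hA1
  refine ⟨p, A, hA, hτ, hA1, hp, fun z W hW0 hW => ?_⟩
  have hA2 : ‖A‖ ≤ 2 * √(Fintype.card n) := by
    nlinarith [norm_le_norm_add_norm_sub' A 1, Real.sqrt_nonneg (Fintype.card n : ℝ)]
  have hp' := abs_le.1 hp
  refine (norm_eigenvalue_twirl_mapMatrix_ofReal_le hM hH hδ0 hδ hA hτ hA2 hW0 hW).trans
    (max_le (abs_of_nonneg ?_).le ?_) <;> linarith

end AlignedEigenvector

section BlochVectors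

theorem isHermitian_pauli (j : Fin 4) : (pauli j).IsHermitian := by
  ext a b
  fin_cases j <;> fin_cases a <;> fin_cases b <;> simp [pauli]

/-- The traceless Hermitian operator `r₀ X + r₁ Y + r₂ Z` with Bloch vector `r`. -/
noncomputable def blochOp : (Fin 3 → ℝ) →ₗ[ℝ] Op :=
  Fintype.linearCombination ℝ fun j : Fin 3 => pauli j.succ

theorem blochOp_apply (r : Fin 3 → ℝ) : blochOp r = ∑ j, r j • pauli j.succ :=
  Fintype.linearCombination_apply ..

theorem blochOp_eq (r : Fin 3 → ℝ) :
    blochOp r = !![(r 2 : ℂ), r 0 - r 1 * Complex.I; r 0 + r 1 * Complex.I, -r 2] := by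
  ext a b
  fin_cases a <;> fin_cases b <;>
    simp [blochOp_apply, Fin.sum_univ_three, pauli, sub_eq_add_neg]

theorem blochOp_single (k : Fin 3) : blochOp (Pi.single k 1) = pauli k.succ := by
  rw [blochOp, Fintype.linearCombination_apply_single, one_smul]

theorem isHermitian_blochOp (r : Fin 3 → ℝ) : (blochOp r).IsHermitian := by
  simp only [Matrix.IsHermitian, blochOp_apply, Matrix.conjTranspose_sum,
    Matrix.conjTranspose_smul, star_trivial, (isHermitian_pauli _).eq]

theorem trace_blochOp (r : Fin 3 → ℝ) : (blochOp r).trace = 0 := by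
  simp [blochOp_eq, Matrix.trace_fin_two]

theorem blochOp_mul (r s : Fin 3 → ℝ) :
    blochOp r * blochOp s = (r ⬝ᵥ s) • (1 : Op) + Complex.I • blochOp (r ⨯₃ s) := by
  rw [blochOp_eq, blochOp_eq, blochOp_eq, cross_apply]
  ext a b
  fin_cases a <;> fin_cases b <;> apply Complex.ext <;>
    simp [Matrix.mul_apply, dotProduct, Fin.sum_univ_three, Fin.sum_univ_two] <;> ring

theorem blochOp_mul_self (r : Fin 3 → ℝ) : blochOp r * blochOp r = (r ⬝ᵥ r) • (1 : Op) := by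
  rw [blochOp_mul, cross_self, map_zero, smul_zero, add_zero]

theorem det_smul_one_add_blochOp (t : ℝ) (r : Fin 3 → ℝ) :
    (t • (1 : Op) + blochOp r).det = ((t ^ 2 - r ⬝ᵥ r : ℝ) : ℂ) := by
  rw [blochOp_eq, Matrix.det_fin_two]
  simp [dotProduct, Fin.sum_univ_three]
  linear_combination ((r 1 : ℂ) ^ 2) * Complex.I_sq

theorem hsInner_blochOp (r s : Fin 3 → ℝ) :
    hsInner (blochOp r) (blochOp s) = ((2 * (r ⬝ᵥ s) : ℝ) : ℂ) := by
  rw [hsInner, (isHermitian_blochOp r).eq, blochOp_mul, Matrix.trace_add, Matrix.trace_smul,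
    Matrix.trace_smul, trace_blochOp, Matrix.trace_one, smul_zero, add_zero, Fintype.card_fin,
    Complex.real_smul]
  push_cast
  ring

/-- The Bloch vector of an operator: a left inverse of `blochOp` that vanishes at the identity. -/
noncomputable def blochVec (X : Op) : Fin 3 → ℝ := fun j => (hsInner (pauli j.succ) X).re / 2

theorem blochVec_blochOp (r : Fin 3 → ℝ) : blochVec (blochOp r) = r := by
  ext j
  rw [blochVec, ← blochOp_single, hsInner_blochOp, Complex.ofReal_re,
    mul_div_cancel_left₀ _ two_ne_zero, single_one_dotProduct]

theorem eq_trace_smul_one_add_blochOp {X : Op} (hX : X.IsHermitian) :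
    X = (X.trace / 2) • (1 : Op) + blochOp (blochVec X) := by
  have h00 : (X 0 0).im = 0 := Complex.conj_eq_iff_im.1 (hX.apply 0 0)
  have h11 : (X 1 1).im = 0 := Complex.conj_eq_iff_im.1 (hX.apply 1 1)
  have h10 : X 1 0 = star (X 0 1) := (hX.apply 1 0).symm
  rw [blochOp_eq]
  ext a b
  fin_cases a <;> fin_cases b <;> apply Complex.ext <;>
    simp [blochVec, hsInner, pauli, Matrix.trace_fin_two, Matrix.mul_apply, Fin.sum_univ_two,
      h00, h11, h10] <;> ring

theorem posSemidef_smul_one_add_blochOp {t : ℝ} (ht : 0 ≤ t) {v : Fin 3 → ℝ}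
    (hv : v ⬝ᵥ v = t ^ 2) : (t • (1 : Op) + blochOp v).PosSemidef := by
  rcases ht.eq_or_lt with rfl | ht
  · rw [zero_pow two_ne_zero, dotProduct_self_eq_zero] at hv
    rw [hv, map_zero, zero_smul, zero_add]
    exact Matrix.PosSemidef.zero
  · have hherm : (t • (1 : Op) + blochOp v).IsHermitian := by
      rw [Matrix.IsHermitian, Matrix.conjTranspose_add, Matrix.conjTranspose_smul,
        Matrix.conjTranspose_one, (isHermitian_blochOp v).eq, star_trivial]
    have hsquare : t • (1 : Op) + blochOp v
        = (2 * t)⁻¹ • ((t • (1 : Op) + blochOp v)ᴴ * (t • (1 : Op) + blochOp v)) := by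
      rw [hherm.eq, eq_inv_smul_iff₀ (by positivity), add_mul, mul_add, mul_add, blochOp_mul_self,
        hv]
      simp only [smul_mul_assoc, mul_smul_comm, one_mul, mul_one]
      module
    rw [hsquare]
    exact (Matrix.posSemidef_conjTranspose_mul_self _).smul (by positivity)

end BlochVectors

section HermitianTP

/-- Linear maps on qubit operators that preserve Hermiticity and the trace. -/
structure IsHermitianTP (Φ : SuperOp) : Prop where
  isHermitian : ∀ X : Op, X.IsHermitian → (Φ X).IsHermitian
  trace_apply : ∀ X : Op, (Φ X).trace = X.trace

/-- The matrix `M` of the affine map `r ↦ M r + c` that a Hermiticity- and trace-preserving map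
induces on Bloch vectors. -/
noncomputable def bloch (Φ : SuperOp) : Matrix (Fin 3) (Fin 3) ℝ :=
  Matrix.of fun j k => blochVec (Φ (pauli k.succ)) j

theorem bloch_eq_of_apply_blochOp {Φ : SuperOp} {M : Matrix (Fin 3) (Fin 3) ℝ}
    (h : ∀ v, Φ (blochOp v) = blochOp (M *ᵥ v)) : bloch Φ = M := by
  ext j k
  rw [bloch, Matrix.of_apply, ← blochOp_single, h, blochVec_blochOp, Matrix.mulVec_single_one,
    Matrix.col_apply]

theorem bloch_one : bloch 1 = 1 :=
  bloch_eq_of_apply_blochOp fun v => by rw [Module.End.one_apply, Matrix.one_mulVec]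

namespace IsHermitianTP

variable {Φ Ψ : SuperOp}

theorem one : IsHermitianTP 1 := ⟨fun _ h => h, fun _ => rfl⟩

theorem mul (hΦ : IsHermitianTP Φ) (hΨ : IsHermitianTP Ψ) : IsHermitianTP (Φ * Ψ) :=
  ⟨fun X h => hΦ.isHermitian _ (hΨ.isHermitian X h),
    fun X => (hΦ.trace_apply _).trans (hΨ.trace_apply X)⟩

theorem apply_pauli_succ (hΦ : IsHermitianTP Φ) (k : Fin 3) :
    Φ (pauli k.succ) = blochOp fun j => bloch Φ j k := by
  have h := eq_trace_smul_one_add_blochOp (hΦ.isHermitian _ (isHermitian_pauli k.succ))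
  rwa [hΦ.trace_apply, ← blochOp_single, trace_blochOp, zero_div, zero_smul, zero_add,
    blochOp_single] at h

theorem apply_blochOp (hΦ : IsHermitianTP Φ) (v : Fin 3 → ℝ) :
    Φ (blochOp v) = blochOp (bloch Φ *ᵥ v) := by
  have hcol : bloch Φ *ᵥ v = ∑ k, v k • fun j => bloch Φ j k := by
    ext j
    simp only [Matrix.mulVec, dotProduct, Finset.sum_apply, Pi.smul_apply, smul_eq_mul, mul_comm]
  rw [hcol, map_sum, blochOp_apply, map_sum]
  simp only [LinearMap.map_smul_of_tower, hΦ.apply_pauli_succ]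

theorem apply_one (hΦ : IsHermitianTP Φ) : Φ 1 = 1 + blochOp (blochVec (Φ 1)) := by
  have h := eq_trace_smul_one_add_blochOp (hΦ.isHermitian 1 Matrix.isHermitian_one)
  rwa [hΦ.trace_apply, Matrix.trace_one, Fintype.card_fin, Nat.cast_ofNat,
    div_self two_ne_zero, one_smul] at h

theorem bloch_mul (hΦ : IsHermitianTP Φ) (hΨ : IsHermitianTP Ψ) :
    bloch (Φ * Ψ) = bloch Φ * bloch Ψ :=
  bloch_eq_of_apply_blochOp fun v => by
    rw [Module.End.mul_apply, hΨ.apply_blochOp, hΦ.apply_blochOp, Matrix.mulVec_mulVec]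

end IsHermitianTP

/-- Linear maps on qubit operators that preserve positivity and the trace. -/
structure IsPositiveTP (Φ : SuperOp) : Prop where
  posSemidef : ∀ X : Op, X.PosSemidef → (Φ X).PosSemidef
  trace_apply : ∀ X : Op, (Φ X).trace = X.trace

theorem IsChannel.isPositiveTP {Φ : SuperOp} (hΦ : IsChannel Φ) : IsPositiveTP Φ where
  posSemidef X hX :=
    (hΦ.completelyPositive 1 (X.submatrix Prod.fst Prod.fst) (hX.submatrix _)).submatrix
      fun i : Fin 2 => (i, (0 : Fin 1))
  trace_apply := hΦ.tracePreserving

namespace IsPositiveTP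

variable {Φ : SuperOp}

theorem isHermitianTP (hΦ : IsPositiveTP Φ) : IsHermitianTP Φ := by
  refine ⟨fun X hX => ?_, hΦ.trace_apply⟩
  have hpolar : X = (1 / 4 : ℝ) • ((X + 1)ᴴ * (X + 1) - (X - 1)ᴴ * (X - 1)) := by
    rw [Matrix.conjTranspose_add, Matrix.conjTranspose_sub, hX.eq, Matrix.conjTranspose_one]
    simp only [add_mul, mul_add, sub_mul, mul_sub, one_mul, mul_one]
    module
  have hpos : ∀ Y : Op, (Φ (Yᴴ * Y)).IsHermitian := fun Y =>
    (hΦ.posSemidef _ (Matrix.posSemidef_conjTranspose_mul_self Y)).isHermitian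
  rw [hpolar, LinearMap.map_smul_of_tower, map_sub]
  exact ((hpos _).sub (hpos _)).smul (IsSelfAdjoint.all _)

theorem dotProduct_bloch_le (hΦ : IsPositiveTP Φ) {t : ℝ} (ht : 0 ≤ t) {v : Fin 3 → ℝ}
    (hv : v ⬝ᵥ v = t ^ 2) :
    (t • blochVec (Φ 1) + bloch Φ *ᵥ v) ⬝ᵥ (t • blochVec (Φ 1) + bloch Φ *ᵥ v) ≤ t ^ 2 := by
  have himage : Φ (t • (1 : Op) + blochOp v)
      = t • (1 : Op) + blochOp (t • blochVec (Φ 1) + bloch Φ *ᵥ v) := by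
    rw [map_add, LinearMap.map_smul_of_tower, hΦ.isHermitianTP.apply_blochOp]
    nth_rw 1 [hΦ.isHermitianTP.apply_one]
    rw [smul_add, map_add, map_smul, add_assoc]
  have hdet := (hΦ.posSemidef _ (posSemidef_smul_one_add_blochOp ht hv)).det_nonneg
  rw [himage, det_smul_one_add_blochOp] at hdet
  exact sub_nonneg.1 (Complex.zero_le_real.1 hdet)

theorem dotProduct_bloch_mulVec_le (hΦ : IsPositiveTP Φ) (v : Fin 3 → ℝ) :
    (bloch Φ *ᵥ v) ⬝ᵥ (bloch Φ *ᵥ v) ≤ v ⬝ᵥ v := by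
  have hpos : ∀ w : Fin 3 → ℝ, 0 ≤ w ⬝ᵥ w := fun w =>
    Finset.sum_nonneg fun j _ => mul_self_nonneg (w j)
  have hsq : v ⬝ᵥ v = √(v ⬝ᵥ v) ^ 2 := (Real.sq_sqrt (hpos v)).symm
  have hplus := hΦ.dotProduct_bloch_le (Real.sqrt_nonneg _) hsq
  have hminus := hΦ.dotProduct_bloch_le (v := -v) (Real.sqrt_nonneg _) (by simpa using hsq)
  have hcenter := hpos (√(v ⬝ᵥ v) • blochVec (Φ 1))
  rw [← hsq, Matrix.mulVec_neg] at hminus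
  rw [← hsq] at hplus
  simp only [add_dotProduct, dotProduct_add, neg_dotProduct, dotProduct_neg] at hplus hminus
  linarith

theorem isContraction_bloch (hΦ : IsPositiveTP Φ) : IsContraction (bloch Φ) := by
  refine .of_dotProduct_mulVec_nonneg
    (Matrix.isHermitian_one.sub (Matrix.isHermitian_conjTranspose_mul_self _)) fun v => ?_
  rw [star_trivial, Matrix.sub_mulVec, Matrix.one_mulVec, dotProduct_sub, sub_nonneg,
    ← Matrix.mulVec_mulVec, Matrix.conjTranspose_eq_transpose_of_trivial,
    Matrix.dotProduct_mulVec, Matrix.vecMul_transpose]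
  exact hΦ.dotProduct_bloch_mulVec_le v

end IsPositiveTP

end HermitianTP

section Rotations

variable (u w : Matrix.unitaryGroup (Fin 2) ℂ)

theorem unitaryGroup_conjTranspose_mul_self : (u : Op)ᴴ * (u : Op) = 1 :=
  Matrix.mem_unitaryGroup_iff'.1 u.2

theorem unitaryChannel_apply (X : Op) : unitaryChannel u X = (u : Op) * X * (u : Op)ᴴ := rfl

theorem unitaryChannel_one : unitaryChannel 1 = 1 :=
  LinearMap.ext fun X => by
    rw [unitaryChannel_apply, OneMemClass.coe_one, Matrix.conjTranspose_one, one_mul, mul_one,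
      Module.End.one_apply]

theorem unitaryChannel_mul : unitaryChannel (u * w) = unitaryChannel u * unitaryChannel w :=
  LinearMap.ext fun X => by
    simp only [unitaryChannel_apply, Module.End.mul_apply, Submonoid.coe_mul,
      Matrix.conjTranspose_mul, mul_assoc]

theorem isHermitianTP_unitaryChannel : IsHermitianTP (unitaryChannel u) where
  isHermitian X hX := Matrix.isHermitian_mul_mul_conjTranspose (u : Op) hX
  trace_apply X := by
    rw [unitaryChannel_apply, Matrix.trace_mul_comm, ← mul_assoc,
      unitaryGroup_conjTranspose_mul_self, one_mul]

theorem hsInner_unitaryChannel (X Y : Op) :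
    hsInner (unitaryChannel u X) (unitaryChannel u Y) = hsInner X Y := by
  rw [hsInner, hsInner, ← (isHermitianTP_unitaryChannel u).trace_apply (Xᴴ * Y)]
  congr 1
  simp only [unitaryChannel_apply, Matrix.conjTranspose_mul, Matrix.conjTranspose_conjTranspose]
  calc (u : Op) * (Xᴴ * (u : Op)ᴴ) * ((u : Op) * Y * (u : Op)ᴴ)
      = (u : Op) * (Xᴴ * ((u : Op)ᴴ * (u : Op)) * Y) * (u : Op)ᴴ := by simp only [mul_assoc]
    _ = (u : Op) * (Xᴴ * Y) * (u : Op)ᴴ := by rw [unitaryGroup_conjTranspose_mul_self, mul_one]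

theorem unitaryChannel_apply_one : unitaryChannel u 1 = 1 := by
  rw [unitaryChannel_apply, mul_one]
  exact Matrix.mem_unitaryGroup_iff.1 u.2

/-- The rotation of the Bloch sphere given by a unitary: the adjoint representation
`U(2) → SO(3)`. -/
noncomputable def rotation : Matrix (Fin 3) (Fin 3) ℝ := bloch (unitaryChannel u)

theorem rotation_one : rotation 1 = 1 := by rw [rotation, unitaryChannel_one, bloch_one]

theorem rotation_mul : rotation (u * w) = rotation u * rotation w := by
  rw [rotation, unitaryChannel_mul,
    (isHermitianTP_unitaryChannel u).bloch_mul (isHermitianTP_unitaryChannel w)]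
  rfl

theorem unitaryChannel_blochOp (v : Fin 3 → ℝ) :
    unitaryChannel u (blochOp v) = blochOp (rotation u *ᵥ v) :=
  (isHermitianTP_unitaryChannel u).apply_blochOp v

theorem dotProduct_rotation_mulVec (v v' : Fin 3 → ℝ) :
    (rotation u *ᵥ v) ⬝ᵥ (rotation u *ᵥ v') = v ⬝ᵥ v' := by
  have h := hsInner_unitaryChannel u (blochOp v) (blochOp v')
  rw [unitaryChannel_blochOp, unitaryChannel_blochOp, hsInner_blochOp, hsInner_blochOp] at h
  exact mul_left_cancel₀ two_ne_zero (Complex.ofReal_injective h)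

theorem rotation_conjTranspose_mul_self : (rotation u)ᴴ * rotation u = 1 := by
  refine Matrix.ext_of_mulVec_single fun k => dotProduct_eq _ _ fun v => ?_
  rw [dotProduct_comm, ← Matrix.mulVec_mulVec, Matrix.dotProduct_mulVec,
    Matrix.conjTranspose_eq_transpose_of_trivial, Matrix.vecMul_transpose,
    dotProduct_rotation_mulVec, Matrix.one_mulVec, dotProduct_comm]

theorem rotation_inv : rotation u⁻¹ = (rotation u)ᴴ := by
  refine (left_inv_eq_right_inv (a := rotation u) ?_
    (mul_eq_one_comm.1 (rotation_conjTranspose_mul_self u)))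
  rw [← rotation_mul, inv_mul_cancel, rotation_one]

theorem conjTranspose_axisOp (r : Fin 3 → ℝ) (c s : ℝ) :
    (c • (1 : Op) - s • Complex.I • blochOp r)ᴴ = c • (1 : Op) + s • Complex.I • blochOp r := by
  simp only [Matrix.conjTranspose_sub, Matrix.conjTranspose_smul, Matrix.conjTranspose_one,
    (isHermitian_blochOp r).eq, star_trivial, Complex.star_def, Complex.conj_I, neg_smul, smul_neg,
    sub_neg_eq_add]

/-- The unitary `exp (-i θ σ_r / 2)`, which rotates the Bloch sphere about the unit vector `r` by
the angle `θ`. -/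
noncomputable def axisUnitary {r : Fin 3 → ℝ} (hr : r ⬝ᵥ r = 1) (θ : ℝ) :
    Matrix.unitaryGroup (Fin 2) ℂ :=
  ⟨Real.cos (θ / 2) • 1 - Real.sin (θ / 2) • Complex.I • blochOp r, by
    rw [Matrix.mem_unitaryGroup_iff, Matrix.star_eq_conjTranspose, conjTranspose_axisOp]
    simp only [sub_mul, mul_add, smul_mul_smul_comm, blochOp_mul_self, hr, one_mul, mul_one,
      Complex.I_mul_I, one_smul]
    linear_combination (norm := module) Real.cos_sq_add_sin_sq (θ / 2) • (1 : Op)⟩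

theorem I_smul_commutator_blochOp (r v : Fin 3 → ℝ) :
    Complex.I • (blochOp v * blochOp r - blochOp r * blochOp v) = (2 : ℝ) • blochOp (r ⨯₃ v) := by
  have hswap : blochOp (v ⨯₃ r) = -blochOp (r ⨯₃ v) := by rw [← cross_anticomm, map_neg]
  rw [blochOp_mul, blochOp_mul, dotProduct_comm v r, hswap, add_sub_add_left_eq_sub, smul_neg,
    ← neg_add', smul_neg, smul_add, smul_smul, Complex.I_mul_I]
  module

theorem blochOp_mul_blochOp_mul_blochOp (r v : Fin 3 → ℝ) :
    blochOp r * blochOp v * blochOp r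
      = (2 * (r ⬝ᵥ v)) • blochOp r - (r ⬝ᵥ r) • blochOp v := by
  have hanti : blochOp v * blochOp r = (2 * (r ⬝ᵥ v)) • (1 : Op) - blochOp r * blochOp v := by
    rw [blochOp_mul, blochOp_mul, dotProduct_comm v r, ← cross_anticomm r v, map_neg]
    module
  rw [mul_assoc, hanti, mul_sub, ← mul_assoc, blochOp_mul_self, smul_mul_assoc, one_mul,
    mul_smul_comm, mul_one]

theorem rotation_axisUnitary {r : Fin 3 → ℝ} (hr : r ⬝ᵥ r = 1) (θ : ℝ) :
    rotation (axisUnitary hr θ) = Real.cos θ • (1 : Matrix (Fin 3) (Fin 3) ℝ)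
      + Real.sin θ • (crossProduct r).toMatrix' + (1 - Real.cos θ) • Matrix.vecMulVec r r := by
  refine bloch_eq_of_apply_blochOp fun v => ?_
  have hcos : Real.cos θ = Real.cos (θ / 2) ^ 2 - Real.sin (θ / 2) ^ 2 := by
    rw [← Real.cos_two_mul', mul_div_cancel₀ _ two_ne_zero]
  have hsin : Real.sin θ = 2 * Real.sin (θ / 2) * Real.cos (θ / 2) := by
    rw [← Real.sin_two_mul, mul_div_cancel₀ _ two_ne_zero]
  have hexpand : unitaryChannel (axisUnitary hr θ) (blochOp v)
      = Real.cos (θ / 2) ^ 2 • blochOp v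
        + (Real.sin (θ / 2) * Real.cos (θ / 2)) •
          Complex.I • (blochOp v * blochOp r - blochOp r * blochOp v)
        + Real.sin (θ / 2) ^ 2 • (blochOp r * blochOp v * blochOp r) := by
    rw [unitaryChannel_apply, axisUnitary, conjTranspose_axisOp]
    simp only [sub_mul, mul_add, smul_mul_assoc, mul_smul_comm, one_mul, mul_one, mul_assoc]
    linear_combination (norm := module)
      -Complex.I_mul_I • Real.sin (θ / 2) ^ 2 • (blochOp r * (blochOp v * blochOp r))
  rw [hexpand, I_smul_commutator_blochOp, blochOp_mul_blochOp_mul_blochOp, hr, hcos, hsin]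
  simp only [Matrix.add_mulVec, Matrix.smul_mulVec, Matrix.one_mulVec, LinearMap.toMatrix'_mulVec,
    Matrix.vecMulVec_mulVec, map_add, map_smul, op_smul_eq_smul]
  linear_combination (norm := module)
    Real.cos_sq_add_sin_sq (θ / 2) • (r ⬝ᵥ v) • blochOp r

end Rotations

section UniformSphere

variable {E : Type*} [NormedAddCommGroup E] [InnerProductSpace ℝ E]

/-- The action of a linear isometry on the unit sphere. -/
def sphereIsometry (f : E ≃ₗᵢ[ℝ] E) : Metric.sphere (0 : E) 1 ≃ₜ Metric.sphere (0 : E) 1 :=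
  f.toHomeomorph.subtype fun x => by simp

theorem coe_sphereIsometry (f : E ≃ₗᵢ[ℝ] E) (x : Metric.sphere (0 : E) 1) :
    (sphereIsometry f x : E) = f x := rfl

theorem image_coe_preimage_sphereIsometry (f : E ≃ₗᵢ[ℝ] E) (s : Set (Metric.sphere (0 : E) 1)) :
    Subtype.val '' (sphereIsometry f ⁻¹' s) = f.symm '' (Subtype.val '' s) := by
  rw [← Homeomorph.image_symm, Set.image_image, Set.image_image]
  rfl

variable [FiniteDimensional ℝ E] [MeasurableSpace E] [BorelSpace E]

open scoped Pointwise in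
theorem measurePreserving_sphereIsometry (f : E ≃ₗᵢ[ℝ] E) :
    MeasurePreserving (sphereIsometry f) (volume : Measure E).toSphere
      (volume : Measure E).toSphere := by
  have hmeas := (sphereIsometry f).continuous.measurable
  refine ⟨hmeas, Measure.ext fun s hs => ?_⟩
  have hcone : Set.Ioo (0 : ℝ) 1 • (Subtype.val '' (sphereIsometry f ⁻¹' s))
      = f ⁻¹' (Set.Ioo (0 : ℝ) 1 • (Subtype.val '' s)) := by
    rw [image_coe_preimage_sphereIsometry, ← f.coe_toHomeomorph, ← Homeomorph.image_symm]
    exact (Set.image_image2_distrib_right fun r x => map_smul f.symm r x).symm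
  rw [Measure.map_apply hmeas hs, Measure.toSphere_apply' _ (hmeas hs),
    Measure.toSphere_apply' _ hs, hcone,
    f.measurePreserving.measure_preimage_emb f.toHomeomorph.measurableEmbedding]

variable (E) in
/-- The uniform probability measure on the unit sphere. -/
noncomputable def uniformSphere : Measure (Metric.sphere (0 : E) 1) :=
  ((volume : Measure E).toSphere Set.univ)⁻¹ • (volume : Measure E).toSphere

instance [Nontrivial E] : IsProbabilityMeasure (uniformSphere E) :=
  have : NeZero (volume : Measure E).toSphere := ⟨Measure.toSphere_ne_zero _⟩
  isProbabilityMeasureSMul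

theorem integral_comp_sphereIsometry (f : E ≃ₗᵢ[ℝ] E) (g : Metric.sphere (0 : E) 1 → ℝ) :
    ∫ x, g (sphereIsometry f x) ∂uniformSphere E = ∫ x, g x ∂uniformSphere E :=
  ((measurePreserving_sphereIsometry f).smul_measure _).integral_comp
    (sphereIsometry f).measurableEmbedding g

theorem integrable_uniformSphere [Nontrivial E] {g : Metric.sphere (0 : E) 1 → ℝ}
    (hg : Continuous g) : Integrable g (uniformSphere E) :=
  hg.integrable_of_hasCompactSupport (HasCompactSupport.of_compactSpace g)

end UniformSphere

section PureStates

theorem pureState_eq_vecMulVec (ψ : EuclideanSpace ℂ (Fin 2)) :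
    pureState ψ = Matrix.vecMulVec ψ (star ψ) := rfl

theorem isHermitian_pureState (ψ : EuclideanSpace ℂ (Fin 2)) : (pureState ψ).IsHermitian := by
  rw [Matrix.IsHermitian, pureState_eq_vecMulVec, Matrix.conjTranspose_vecMulVec, star_star]

theorem trace_pureState (ψ : EuclideanSpace ℂ (Fin 2)) :
    (pureState ψ).trace = ((‖ψ‖ ^ 2 : ℝ) : ℂ) := by
  rw [pureState_eq_vecMulVec, Matrix.trace_vecMulVec, EuclideanSpace.norm_sq_eq]
  simp only [dotProduct, Pi.star_apply, Complex.star_def, Complex.mul_conj,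
    Complex.normSq_eq_norm_sq, Complex.ofReal_sum]

theorem det_pureState (ψ : EuclideanSpace ℂ (Fin 2)) : (pureState ψ).det = 0 := by
  rw [pureState_eq_vecMulVec, Matrix.det_vecMulVec]

/-- The isometry of `ℂ²` given by a unitary. -/
noncomputable def ketIsometry (u : Matrix.unitaryGroup (Fin 2) ℂ) :
    EuclideanSpace ℂ (Fin 2) ≃ₗᵢ[ℝ] EuclideanSpace ℂ (Fin 2) :=
  let e : EuclideanSpace ℂ (Fin 2) ≃ₗᵢ[ℂ] EuclideanSpace ℂ (Fin 2) :=
    Unitary.linearIsometryEquiv ⟨Matrix.toEuclideanCLM (𝕜 := ℂ) (u : Op), Unitary.map_mem _ u.2⟩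
  { e.toLinearEquiv.restrictScalars ℝ with norm_map' := e.norm_map }

theorem pureState_ketIsometry (u : Matrix.unitaryGroup (Fin 2) ℂ)
    (ψ : EuclideanSpace ℂ (Fin 2)) :
    pureState (ketIsometry u ψ) = unitaryChannel u (pureState ψ) := by
  have h : (ketIsometry u ψ).ofLp = (u : Op) *ᵥ ψ.ofLp := rfl
  rw [unitaryChannel_apply, pureState_eq_vecMulVec, pureState_eq_vecMulVec, h,
    Matrix.mul_vecMulVec, Matrix.vecMulVec_mul, Matrix.star_mulVec]

/-- The unit vectors of `ℂ²`. -/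
abbrev Ket : Type := Metric.sphere (0 : EuclideanSpace ℂ (Fin 2)) 1

/-- The uniform distribution of kets, which `avgFidelity` averages over. -/
noncomputable abbrev uniformKet : Measure Ket := uniformSphere (EuclideanSpace ℂ (Fin 2))

/-- The Bloch vector of the pure state of a unit vector. -/
noncomputable def stateVec (ψ : Ket) : Fin 3 → ℝ :=
  blochVec (pureState ψ)

theorem pureState_eq_add_blochOp (ψ : Ket) :
    pureState ψ = (1 / 2 : ℝ) • (1 : Op) + blochOp (stateVec ψ) := by
  have h := eq_trace_smul_one_add_blochOp (isHermitian_pureState ψ)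
  rwa [trace_pureState, norm_eq_of_mem_sphere, one_pow, ← Complex.ofReal_ofNat,
    ← Complex.ofReal_div, Complex.coe_smul] at h

theorem dotProduct_stateVec_self (ψ : Ket) :
    stateVec ψ ⬝ᵥ stateVec ψ = 1 / 4 := by
  have h := det_pureState ψ
  rw [pureState_eq_add_blochOp, det_smul_one_add_blochOp, Complex.ofReal_eq_zero] at h
  linarith

theorem continuous_stateVec (j : Fin 3) : Continuous fun ψ => stateVec ψ j := by
  simp only [stateVec, blochVec, hsInner, pureState_eq_vecMulVec]
  fun_prop

theorem integrable_stateVec (j : Fin 3) : Integrable (fun ψ => stateVec ψ j) uniformKet :=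
  integrable_uniformSphere (continuous_stateVec j)

theorem integrable_stateVec_mul (j k : Fin 3) :
    Integrable (fun ψ => stateVec ψ j * stateVec ψ k) uniformKet :=
  integrable_uniformSphere ((continuous_stateVec j).mul (continuous_stateVec k))

theorem stateVec_sphereIsometry (u : Matrix.unitaryGroup (Fin 2) ℂ) (ψ : Ket) :
    stateVec (sphereIsometry (ketIsometry u) ψ) = rotation u *ᵥ stateVec ψ := by
  have h := pureState_ketIsometry u ψ
  rw [pureState_eq_add_blochOp ψ, map_add, LinearMap.map_smul_of_tower, unitaryChannel_apply_one,
    unitaryChannel_blochOp, ← coe_sphereIsometry, pureState_eq_add_blochOp] at h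
  rw [← blochVec_blochOp (stateVec _), add_left_cancel h, blochVec_blochOp]

theorem integral_halfTurn {r : Fin 3 → ℝ} (hr : r ⬝ᵥ r = 1) (g : (Fin 3 → ℝ) → ℝ) :
    ∫ ψ, g ((2 * (r ⬝ᵥ stateVec ψ)) • r - stateVec ψ) ∂uniformKet
      = ∫ ψ, g (stateVec ψ) ∂uniformKet := by
  have hrot : ∀ v, rotation (axisUnitary hr Real.pi) *ᵥ v = (2 * (r ⬝ᵥ v)) • r - v := fun v => by
    rw [rotation_axisUnitary, Real.cos_pi, Real.sin_pi, zero_smul, add_zero, Matrix.add_mulVec,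
      Matrix.smul_mulVec, Matrix.one_mulVec, Matrix.smul_mulVec, Matrix.vecMulVec_mulVec,
      op_smul_eq_smul]
    module
  have h := integral_comp_sphereIsometry (ketIsometry (axisUnitary hr Real.pi))
    fun ψ => g (stateVec ψ)
  simpa only [stateVec_sphereIsometry, hrot] using h

theorem integral_stateVec (j : Fin 3) : ∫ ψ, stateVec ψ j ∂uniformKet = 0 := by
  obtain ⟨k, hk⟩ := exists_ne j
  have h := integral_halfTurn (r := Pi.single k 1) (by simp) fun v => v j
  simp only [Pi.sub_apply, Pi.smul_apply, Pi.single_eq_of_ne hk.symm, smul_zero, zero_sub,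
    integral_neg] at h
  linarith

theorem integral_stateVec_mul_of_ne {j k : Fin 3} (hjk : j ≠ k) :
    ∫ ψ, stateVec ψ j * stateVec ψ k ∂uniformKet = 0 := by
  have h := integral_halfTurn (r := Pi.single j 1) (by simp) fun v => v j * v k
  simp only [Pi.sub_apply, Pi.smul_apply, Pi.single_eq_of_ne hjk.symm, Pi.single_eq_same,
    smul_eq_mul, single_one_dotProduct, mul_one, mul_zero, two_mul,
    add_sub_cancel_right, zero_sub, mul_neg, integral_neg] at h
  linarith

theorem integral_stateVec_mul_self_eq (j k : Fin 3) :
    ∫ ψ, stateVec ψ j * stateVec ψ j ∂uniformKet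
      = ∫ ψ, stateVec ψ k * stateVec ψ k ∂uniformKet := by
  rcases eq_or_ne j k with rfl | hjk
  · rfl
  have hhalf : √2⁻¹ * √2⁻¹ = (2⁻¹ : ℝ) := Real.mul_self_sqrt (by norm_num)
  let r : Fin 3 → ℝ := √2⁻¹ • (Pi.single j 1 + Pi.single k 1)
  have hdot : ∀ v, r ⬝ᵥ v = √2⁻¹ * (v j + v k) := fun v => by
    rw [smul_dotProduct, add_dotProduct, single_one_dotProduct, single_one_dotProduct, smul_eq_mul]
  have hj : r j = √2⁻¹ := by simp [r, hjk]
  have hk : r k = √2⁻¹ := by simp [r, hjk.symm]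
  have hr : r ⬝ᵥ r = 1 := by
    rw [hdot, hj, hk]
    linarith
  have hswap : ∀ v, ((2 * (r ⬝ᵥ v)) • r - v) j = v k := fun v => by
    rw [Pi.sub_apply, Pi.smul_apply, hj, hdot, smul_eq_mul]
    linear_combination 2 * (v j + v k) * hhalf
  rw [← integral_halfTurn hr fun v => v j * v j]
  simp only [hswap]

theorem integral_stateVec_mul_self (j : Fin 3) :
    ∫ ψ, stateVec ψ j * stateVec ψ j ∂uniformKet = 1 / 12 := by
  have hsum : ∑ k, ∫ ψ, stateVec ψ k * stateVec ψ k ∂uniformKet = 1 / 4 := by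
    rw [← integral_finsetSum _ fun k _ => integrable_stateVec_mul k k]
    change ∫ ψ, stateVec ψ ⬝ᵥ stateVec ψ ∂uniformKet = _
    simp only [dotProduct_stateVec_self, integral_const, probReal_univ, one_smul]
  rw [Finset.sum_congr rfl fun k _ => integral_stateVec_mul_self_eq k j, Finset.sum_const,
    Finset.card_univ, Fintype.card_fin, nsmul_eq_mul, Nat.cast_ofNat] at hsum
  linarith

theorem integrable_dotProduct_stateVec (c : Fin 3 → ℝ) :
    Integrable (fun ψ => c ⬝ᵥ stateVec ψ) uniformKet :=
  integrable_finsetSum _ fun j _ => (integrable_stateVec j).const_mul _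

theorem integral_dotProduct_stateVec (c : Fin 3 → ℝ) :
    ∫ ψ, c ⬝ᵥ stateVec ψ ∂uniformKet = 0 := by
  simp only [dotProduct]
  rw [integral_finsetSum _ fun j _ => (integrable_stateVec j).const_mul _]
  simp only [integral_const_mul, integral_stateVec, mul_zero, Finset.sum_const_zero]

theorem dotProduct_mulVec_eq_sum {n : Type*} [Fintype n] (B : Matrix n n ℝ) (v : n → ℝ) :
    v ⬝ᵥ B *ᵥ v = ∑ j, ∑ k, B j k * (v j * v k) := by
  simp only [dotProduct, Matrix.mulVec, Finset.mul_sum, mul_left_comm]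

theorem integrable_dotProduct_mulVec_stateVec (B : Matrix (Fin 3) (Fin 3) ℝ) :
    Integrable (fun ψ => stateVec ψ ⬝ᵥ B *ᵥ stateVec ψ) uniformKet := by
  simp only [dotProduct_mulVec_eq_sum]
  exact integrable_finsetSum _ fun j _ => integrable_finsetSum _ fun k _ =>
    (integrable_stateVec_mul j k).const_mul _

theorem integral_dotProduct_mulVec_stateVec (B : Matrix (Fin 3) (Fin 3) ℝ) :
    ∫ ψ, stateVec ψ ⬝ᵥ B *ᵥ stateVec ψ ∂uniformKet = B.trace / 12 := by
  have hint : ∀ j k, Integrable (fun ψ => B j k * (stateVec ψ j * stateVec ψ k)) uniformKet :=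
    fun j k => (integrable_stateVec_mul j k).const_mul _
  have hrow : ∀ j, ∑ k, ∫ ψ, B j k * (stateVec ψ j * stateVec ψ k) ∂uniformKet = B j j / 12 := by
    intro j
    rw [Finset.sum_eq_single j, integral_const_mul, integral_stateVec_mul_self, mul_one_div]
    · intro k _ hkj
      rw [integral_const_mul, integral_stateVec_mul_of_ne hkj.symm, mul_zero]
    · simp
  simp only [dotProduct_mulVec_eq_sum]
  rw [integral_finsetSum _ fun j _ => integrable_finsetSum _ fun k _ => hint j k]
  simp only [integral_finsetSum _ fun k _ => hint _ k, hrow, ← Finset.sum_div]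
  rfl

theorem hsInner_half_smul_one_add_blochOp (r s : Fin 3 → ℝ) :
    hsInner ((1 / 2 : ℝ) • (1 : Op) + blochOp r) ((1 / 2 : ℝ) • (1 : Op) + blochOp s)
      = ((1 / 2 + 2 * (r ⬝ᵥ s) : ℝ) : ℂ) := by
  have h := hsInner_blochOp r s
  rw [hsInner] at h ⊢
  rw [Matrix.conjTranspose_add, add_mul, mul_add, mul_add, Matrix.trace_add, Matrix.trace_add,
    Matrix.trace_add, h, (isHermitian_blochOp r).eq]
  simp [trace_blochOp]

theorem IsHermitianTP.apply_pureState {Φ : SuperOp} (hΦ : IsHermitianTP Φ) (ψ : Ket) :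
    Φ (pureState ψ) = (1 / 2 : ℝ) • (1 : Op)
      + blochOp ((1 / 2 : ℝ) • blochVec (Φ 1) + bloch Φ *ᵥ stateVec ψ) := by
  rw [pureState_eq_add_blochOp, map_add, LinearMap.map_smul_of_tower, hΦ.apply_blochOp]
  nth_rw 1 [hΦ.apply_one]
  rw [smul_add, map_add, map_smul, add_assoc]

theorem re_hsInner_apply_pureState {Φ : SuperOp} (hΦ : IsHermitianTP Φ)
    (u : Matrix.unitaryGroup (Fin 2) ℂ) (ψ : Ket) :
    (hsInner (Φ (pureState ψ)) (unitaryChannel u (pureState ψ))).re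
      = 1 / 2 + ((blochVec (Φ 1) ᵥ* rotation u) ⬝ᵥ stateVec ψ
        + 2 * (stateVec ψ ⬝ᵥ ((bloch Φ)ᴴ * rotation u) *ᵥ stateVec ψ)) := by
  have hunitary : unitaryChannel u (pureState ψ)
      = (1 / 2 : ℝ) • (1 : Op) + blochOp (rotation u *ᵥ stateVec ψ) := by
    rw [pureState_eq_add_blochOp, map_add, LinearMap.map_smul_of_tower, unitaryChannel_apply_one,
      unitaryChannel_blochOp]
  rw [hΦ.apply_pureState, hunitary, hsInner_half_smul_one_add_blochOp, Complex.ofReal_re,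
    add_dotProduct, smul_dotProduct, smul_eq_mul, ← Matrix.mulVec_mulVec,
    Matrix.dotProduct_mulVec (stateVec ψ), Matrix.conjTranspose_eq_transpose_of_trivial,
    Matrix.vecMul_transpose, Matrix.dotProduct_mulVec (blochVec (Φ 1))]
  ring

theorem avgFidelity_unitaryChannel {Φ : SuperOp} (hΦ : IsHermitianTP Φ)
    (u : Matrix.unitaryGroup (Fin 2) ℂ) :
    avgFidelity Φ (unitaryChannel u)
      = 1 / 2 + normalizedTrace ℝ (Fin 3) (bloch Φ * (rotation u)ᴴ) / 2 := by
  change ∫ ψ : Ket, (hsInner (Φ (pureState ψ)) (unitaryChannel u (pureState ψ))).re ∂uniformKet = _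
  have hlin := integrable_dotProduct_stateVec (blochVec (Φ 1) ᵥ* rotation u)
  have hquad := (integrable_dotProduct_mulVec_stateVec ((bloch Φ)ᴴ * rotation u)).const_mul 2
  simp only [re_hsInner_apply_pureState hΦ u]
  rw [integral_add (integrable_const _) (hlin.fun_add hquad), integral_add hlin hquad,
    integral_const_mul, integral_dotProduct_stateVec, integral_dotProduct_mulVec_stateVec,
    integral_const, probReal_univ, one_smul, normalizedTrace_apply, Fintype.card_fin,
    ← star_trivial (bloch Φ * (rotation u)ᴴ).trace, ← Matrix.trace_conjTranspose,
    Matrix.conjTranspose_mul, Matrix.conjTranspose_conjTranspose, Matrix.trace_mul_comm]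
  push_cast
  ring

end PureStates

section TwoDesign

variable {ι : Type*} [Fintype ι]

/-- The linear map that acts on Bloch vectors as the matrix `X` and annihilates the identity. -/
noncomputable def blochLift (X : Matrix (Fin 3) (Fin 3) ℝ) : SuperOp where
  toFun Y := ∑ j, (∑ k, (X j k : ℂ) * (hsInner (pauli k.succ) Y / 2)) • pauli j.succ
  map_add' Y Z := by
    simp only [hsInner, mul_add, Matrix.trace_add, add_div, Finset.sum_add_distrib, add_smul]
  map_smul' c Y := by
    simp only [hsInner, mul_smul_comm, Matrix.trace_smul, smul_div_assoc, ← Finset.smul_sum,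
      smul_assoc, RingHom.id_apply]

theorem blochLift_apply (X : Matrix (Fin 3) (Fin 3) ℝ) (Y : Op) :
    blochLift X Y = ∑ j, (∑ k, (X j k : ℂ) * (hsInner (pauli k.succ) Y / 2)) • pauli j.succ :=
  rfl

theorem blochLift_blochOp (X : Matrix (Fin 3) (Fin 3) ℝ) (v : Fin 3 → ℝ) :
    blochLift X (blochOp v) = blochOp (X *ᵥ v) := by
  rw [blochLift_apply, blochOp_apply (X *ᵥ v)]
  refine Finset.sum_congr rfl fun j _ => ?_
  rw [← Complex.coe_smul, Matrix.mulVec, dotProduct, Complex.ofReal_sum]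
  congr 1
  refine Finset.sum_congr rfl fun k _ => ?_
  rw [← blochOp_single, hsInner_blochOp, single_one_dotProduct]
  push_cast
  ring

theorem blochVec_smul_blochOp (a : ℂ) (v : Fin 3 → ℝ) : blochVec (a • blochOp v) = a.re • v := by
  ext j
  rw [blochVec, hsInner, mul_smul_comm, Matrix.trace_smul, ← hsInner, ← blochOp_single,
    hsInner_blochOp, smul_eq_mul, Complex.re_mul_ofReal, single_one_dotProduct, Pi.smul_apply,
    smul_eq_mul]
  ring

theorem blochVec_smul_one (a : ℂ) : blochVec (a • (1 : Op)) = 0 := by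
  ext j
  rw [blochVec, hsInner, mul_smul_comm, mul_one, Matrix.trace_smul, Matrix.trace_conjTranspose,
    ← blochOp_single, trace_blochOp, star_zero, smul_zero, Complex.zero_re, zero_div,
    Pi.zero_apply]

theorem inv_card_smul_sum_unitaryChannel_blochOp (u : ι → Matrix.unitaryGroup (Fin 2) ℂ)
    (v : ι → Fin 3 → ℝ) :
    (Fintype.card ι : ℂ)⁻¹ • ∑ i, unitaryChannel (u i) (blochOp (v i))
      = blochOp ((Fintype.card ι : ℝ)⁻¹ • ∑ i, rotation (u i) *ᵥ v i) := by
  simp only [unitaryChannel_blochOp]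
  rw [← map_sum, map_smul, ← Complex.coe_smul, Complex.ofReal_inv, Complex.ofReal_natCast]

theorem IsTwoDesign.isDepolarizing_rotation [Nonempty ι]
    {u : ι → Matrix.unitaryGroup (Fin 2) ℂ} (hu : IsTwoDesign u) :
    IsDepolarizing fun i => rotation (u i) := by
  refine isDepolarizing_of_forall_exists_eq_smul_one
    (fun i => rotation_conjTranspose_mul_self (u i)) fun X => ?_
  obtain ⟨a, b, hab⟩ := hu (blochLift X)
  refine ⟨a.re, Matrix.ext_of_mulVec_single fun k => ?_⟩
  have h := congrArg blochVec (hab (blochOp (Pi.single k 1)))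
  simp only [Module.End.mul_apply, unitaryChannel_blochOp _⁻¹, blochLift_blochOp] at h
  rw [inv_card_smul_sum_unitaryChannel_blochOp, blochVec_blochOp, trace_blochOp, mul_zero,
    zero_smul, add_zero, blochVec_smul_blochOp] at h
  simp only [rotation_inv, Matrix.mulVec_mulVec, ← mul_assoc] at h
  rw [← Matrix.sum_mulVec, ← Matrix.smul_mulVec] at h
  rw [twirl_apply, h, Matrix.smul_mulVec, Matrix.one_mulVec]

theorem IsTwoDesign.sum_rotation [Nonempty ι] {u : ι → Matrix.unitaryGroup (Fin 2) ℂ}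
    (hu : IsTwoDesign u) : ∑ i, rotation (u i) = 0 := by
  refine Matrix.ext_of_mulVec_single fun k => ?_
  obtain ⟨a, b, hab⟩ :=
    hu ((Matrix.traceLinearMap (Fin 2) ℂ ℂ).smulRight (blochOp (Pi.single k 1)))
  have h := congrArg blochVec (hab ((2⁻¹ : ℂ) • 1))
  simp only [Module.End.mul_apply, LinearMap.smulRight_apply, Matrix.traceLinearMap_apply,
    map_smul, unitaryChannel_apply_one, Matrix.trace_smul, Matrix.trace_one, Fintype.card_fin,
    Nat.cast_ofNat, inv_smul_smul₀ (two_ne_zero (α := ℂ))] at h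
  rw [inv_card_smul_sum_unitaryChannel_blochOp, blochVec_blochOp, smul_smul, ← add_smul,
    blochVec_smul_one, ← Matrix.sum_mulVec] at h
  rw [Matrix.zero_mulVec]
  exact (smul_eq_zero.1 h).resolve_left (inv_ne_zero (Nat.cast_ne_zero.2 Fintype.card_ne_zero))

end TwoDesign

section Circuits

variable {ι : Type*} {G H : ι → SuperOp}

theorem isHermitianTP_circuit (hG : ∀ i, IsHermitianTP (G i)) (m : ℕ) (s : Fin m → ι) :
    IsHermitianTP (circuit G m s) := by
  induction m with
  | zero => exact IsHermitianTP.one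
  | succ m ih => exact (hG _).mul (ih _)

theorem exists_circuit_eq_unitaryChannel (w : ι → Matrix.unitaryGroup (Fin 2) ℂ) (m : ℕ)
    (s : Fin m → ι) : ∃ W, circuit (idealGates w) m s = unitaryChannel W := by
  induction m with
  | zero => exact ⟨1, unitaryChannel_one.symm⟩
  | succ m ih =>
    obtain ⟨W, hW⟩ := ih fun k => s k.castSucc
    exact ⟨w (s (Fin.last m)) * W, by rw [circuit, hW, unitaryChannel_mul, idealGates]⟩

theorem bloch_circuit_succ (hG : ∀ i, IsHermitianTP (G i)) (m : ℕ) (s : Fin (m + 1) → ι) :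
    bloch (circuit G (m + 1) s)
      = bloch (G (s (Fin.last m))) * bloch (circuit G m fun k => s k.castSucc) :=
  (hG _).bloch_mul (isHermitianTP_circuit hG m _)

variable [Fintype ι] [Nonempty ι]

theorem sum_bloch_circuit_mul_conjTranspose (hG : ∀ i, IsHermitianTP (G i))
    (hH : ∀ i, IsHermitianTP (H i)) (m : ℕ) :
    ∑ s, bloch (circuit G m s) * (bloch (circuit H m s))ᴴ
      = (Fintype.card ι : ℝ) ^ m
        • (twirl (fun i => bloch (G i)) (fun i => bloch (H i)) ^ m) 1 := by
  induction m with
  | zero => simp [circuit, bloch_one]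
  | succ m ih =>
    rw [← (Fin.snocEquiv fun _ => ι).sum_comp, Fintype.sum_prod_type]
    have hterm : ∀ i s, bloch (circuit G (m + 1) (Fin.snocEquiv (fun _ => ι) (i, s)))
          * (bloch (circuit H (m + 1) (Fin.snocEquiv (fun _ => ι) (i, s))))ᴴ
        = bloch (G i) * (bloch (circuit G m s) * (bloch (circuit H m s))ᴴ) * (bloch (H i))ᴴ :=
      fun i s => by
        simp only [bloch_circuit_succ hG, bloch_circuit_succ hH, Fin.snocEquiv_apply,
          Fin.snoc_last, Fin.snoc_castSucc, Matrix.conjTranspose_mul, mul_assoc]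
    simp only [hterm, ← Finset.sum_mul, ← Finset.mul_sum, ih]
    rw [pow_succ' (twirl _ _), Module.End.mul_apply, twirl_apply, smul_smul, pow_succ,
      mul_inv_cancel_right₀ (Nat.cast_ne_zero.2 Fintype.card_ne_zero), Finset.smul_sum]
    simp only [mul_smul_comm, smul_mul_assoc]

theorem gateSetFidelity_idealGates (hG : ∀ i, IsHermitianTP (G i))
    (w : ι → Matrix.unitaryGroup (Fin 2) ℂ) (m : ℕ) :
    gateSetFidelity G (idealGates w) m = 1 / 2 + normalizedTrace ℝ (Fin 3)
      ((twirl (fun i => bloch (G i)) (fun i => rotation (w i)) ^ m) 1) / 2 := by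
  have hterm : ∀ s : Fin m → ι, avgFidelity (circuit G m s) (circuit (idealGates w) m s)
      = 1 / 2 + normalizedTrace ℝ (Fin 3)
        (bloch (circuit G m s) * (bloch (circuit (idealGates w) m s))ᴴ) / 2 := fun s => by
    obtain ⟨W, hW⟩ := exists_circuit_eq_unitaryChannel w m s
    rw [hW, avgFidelity_unitaryChannel (isHermitianTP_circuit hG m s), rotation]
  have hsum := congrArg (normalizedTrace ℝ (Fin 3)) (sum_bloch_circuit_mul_conjTranspose hG
    (H := idealGates w) (fun i => isHermitianTP_unitaryChannel (w i)) m)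
  rw [map_sum, map_smul, smul_eq_mul] at hsum
  have hcard : (Fintype.card ι : ℝ) ^ m ≠ 0 :=
    pow_ne_zero m (Nat.cast_ne_zero.2 Fintype.card_ne_zero)
  rw [gateSetFidelity, Finset.sum_congr rfl fun s _ => hterm s, Finset.sum_add_distrib,
    ← Finset.sum_div, ← Finset.sum_div, hsum, Finset.sum_const, Finset.card_univ, Fintype.card_fun,
    Fintype.card_fin, nsmul_eq_mul, Nat.cast_pow]
  field_simp
  rfl

end Circuits

section Superchannel

/-- The inclusion of the traceless operators into all operators, in Pauli coordinates. -/
def tracelessInclusion : Matrix (Fin 4) (Fin 3) ℂ :=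
  (1 : Matrix (Fin 4) (Fin 4) ℂ).submatrix id Fin.succ

theorem mul_tracelessInclusion_apply {m : Type*} (X : Matrix m (Fin 4) ℂ) (i : m) (k : Fin 3) :
    (X * tracelessInclusion) i k = X i k.succ := by
  simp [tracelessInclusion, Matrix.mul_apply, Matrix.one_apply]

theorem tracelessInclusion_mul_apply_zero {n : Type*} (X : Matrix (Fin 3) n ℂ) (k : n) :
    (tracelessInclusion * X) 0 k = 0 := by
  simp [tracelessInclusion, Matrix.mul_apply, (Fin.succ_ne_zero _).symm]

theorem tracelessInclusion_mul_apply_succ {n : Type*} (X : Matrix (Fin 3) n ℂ) (j : Fin 3) (k : n) :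
    (tracelessInclusion * X) j.succ k = X j k := by
  simp [tracelessInclusion, Matrix.mul_apply, Matrix.one_apply]

theorem transpose_tracelessInclusion_mul_self : tracelessInclusionᵀ * tracelessInclusion = 1 := by
  ext j k
  rw [mul_tracelessInclusion_apply, tracelessInclusion]
  simp [Matrix.one_apply, eq_comm]

theorem injective_tracelessInclusion_mul_mul_transpose :
    Function.Injective fun W : Matrix (Fin 3) (Fin 3) ℂ =>
      tracelessInclusion * W * tracelessInclusionᵀ :=
  Function.LeftInverse.injective (g := fun X => tracelessInclusionᵀ * X * tracelessInclusion)
    fun W => by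
      simp only [Matrix.mul_assoc, transpose_tracelessInclusion_mul_self, Matrix.mul_one]
      rw [← Matrix.mul_assoc, transpose_tracelessInclusion_mul_self, Matrix.one_mul]

theorem tracelessInclusion_mul_transpose_mul {n : Type*} {X : Matrix (Fin 4) n ℂ}
    (hX : ∀ k, X 0 k = 0) : tracelessInclusion * (tracelessInclusionᵀ * X) = X := by
  ext j k
  refine Fin.cases ?_ (fun j => ?_) j
  · rw [tracelessInclusion_mul_apply_zero, hX]
  · rw [tracelessInclusion_mul_apply_succ, ← Matrix.transpose_apply (tracelessInclusionᵀ * X),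
      Matrix.transpose_mul, Matrix.transpose_transpose, mul_tracelessInclusion_apply,
      Matrix.transpose_apply]

theorem hsInner_pauli_zero (X : Op) : hsInner (pauli 0) X = X.trace := by
  rw [hsInner, (isHermitian_pauli 0).eq]
  exact congrArg Matrix.trace (one_mul X)

theorem liouville_apply_zero {Φ : SuperOp} (hΦ : IsHermitianTP Φ) (k : Fin 4) :
    liouville Φ 0 k = (1 : Matrix (Fin 4) (Fin 4) ℂ) 0 k := by
  rw [liouville, Matrix.of_apply, hsInner_pauli_zero, hΦ.trace_apply]
  refine Fin.cases ?_ (fun k => ?_) k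
  · simp [pauli]
  · rw [← blochOp_single, trace_blochOp, zero_div, Matrix.one_apply_ne (Fin.succ_ne_zero k).symm]

theorem liouville_mul_apply_zero {Φ : SuperOp} (hΦ : IsHermitianTP Φ) {n : Type*}
    (X : Matrix (Fin 4) n ℂ) (k : n) : (liouville Φ * X) 0 k = X 0 k := by
  simp only [Matrix.mul_apply, liouville_apply_zero hΦ]
  rw [← Matrix.mul_apply, Matrix.one_mul]

theorem liouville_mul_tracelessInclusion {Φ : SuperOp} (hΦ : IsHermitianTP Φ) :
    liouville Φ * tracelessInclusion
      = tracelessInclusion * Complex.ofRealHom.mapMatrix (bloch Φ) := by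
  ext j k
  rw [mul_tracelessInclusion_apply]
  refine Fin.cases ?_ (fun j => ?_) j
  · rw [tracelessInclusion_mul_apply_zero, liouville_apply_zero hΦ,
      Matrix.one_apply_ne (Fin.succ_ne_zero k).symm]
  · rw [tracelessInclusion_mul_apply_succ, liouville, Matrix.of_apply, hΦ.apply_pauli_succ,
      ← blochOp_single, hsInner_blochOp, single_one_dotProduct]
    simp

theorem liouville_mul_tracelessProj (Φ : SuperOp) :
    liouville (Φ * tracelessProj) = liouville Φ * tracelessInclusion * tracelessInclusionᵀ := by
  ext j k
  rw [← Matrix.transpose_apply (_ * tracelessInclusionᵀ), Matrix.transpose_mul,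
    Matrix.transpose_transpose]
  refine Fin.cases ?_ (fun k => ?_) k
  · have h0 : tracelessProj (pauli 0) = 0 := by simp [tracelessProj, pauli]
    rw [tracelessInclusion_mul_apply_zero, liouville, Matrix.of_apply, Module.End.mul_apply, h0,
      map_zero, hsInner, mul_zero, Matrix.trace_zero, zero_div]
  · have hk : tracelessProj (pauli k.succ) = pauli k.succ := by
      rw [tracelessProj, LinearMap.coe_mk, AddHom.coe_mk, ← blochOp_single, trace_blochOp,
        zero_div, zero_smul, sub_zero]
    rw [tracelessInclusion_mul_apply_succ, Matrix.transpose_apply, mul_tracelessInclusion_apply,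
      liouville, Matrix.of_apply, Module.End.mul_apply, hk, liouville, Matrix.of_apply]

theorem mem_spectrum_iff_exists_mulVec {n : Type*} [Fintype n] [DecidableEq n] (T : Matrix n n ℂ)
    (z : ℂ) : z ∈ spectrum ℂ T ↔ ∃ w, w ≠ 0 ∧ T *ᵥ w = z • w := by
  rw [← Matrix.spectrum_toLin', ← Module.End.hasEigenvalue_iff_mem_spectrum]
  constructor
  · intro h
    obtain ⟨w, hw⟩ := h.exists_hasEigenvector
    exact ⟨w, hw.2, by simpa using hw.apply_eq_smul⟩
  · rintro ⟨w, hw0, hw⟩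
    exact Module.End.hasEigenvalue_of_hasEigenvector
      ⟨Module.End.mem_eigenspace_iff.2 (by simpa using hw), hw0⟩

variable {ι : Type*} [Fintype ι] {G : ι → SuperOp} {u : ι → Matrix.unitaryGroup (Fin 2) ℂ} {z : ℂ}

theorem twirlingSuperchannel_mulVec_vec (X : Matrix (Fin 4) (Fin 4) ℂ) :
    twirlingSuperchannel G (idealGates u) *ᵥ X.vec = Matrix.vec
      ((Fintype.card ι : ℂ)⁻¹ • ∑ i, liouville (G i) * (X * tracelessInclusion
        * (Complex.ofRealHom.mapMatrix (rotation (u i)))ᴴ * tracelessInclusionᵀ)) := by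
  have hterm : ∀ i, (liouville (idealGates u i * tracelessProj))ᵀ
      = tracelessInclusion * (Complex.ofRealHom.mapMatrix (rotation (u i)))ᴴ
        * tracelessInclusionᵀ := fun i => by
    rw [idealGates, liouville_mul_tracelessProj,
      liouville_mul_tracelessInclusion (isHermitianTP_unitaryChannel (u i)), Matrix.transpose_mul,
      Matrix.transpose_mul, Matrix.transpose_transpose, conjTranspose_mapMatrix_ofReal,
      Matrix.conjTranspose_eq_transpose_of_trivial, ← Matrix.mul_assoc]
    rfl
  simp only [twirlingSuperchannel, Matrix.smul_mulVec, Matrix.sum_mulVec,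
    Matrix.kronecker_mulVec_vec, hterm, Matrix.vec_smul, Matrix.vec_sum, Matrix.mul_assoc]

theorem twirlingSuperchannel_mulVec_vec_tracelessInclusion (hG : ∀ i, IsHermitianTP (G i))
    (W : Matrix (Fin 3) (Fin 3) ℂ) :
    twirlingSuperchannel G (idealGates u)
        *ᵥ (tracelessInclusion * W * tracelessInclusionᵀ).vec = Matrix.vec
      (tracelessInclusion * twirl (fun i => Complex.ofRealHom.mapMatrix (bloch (G i)))
        (fun i => Complex.ofRealHom.mapMatrix (rotation (u i))) W * tracelessInclusionᵀ) := by
  have hterm : ∀ i (Y : Matrix (Fin 3) (Fin 4) ℂ), liouville (G i) * (tracelessInclusion * Y)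
      = tracelessInclusion * (Complex.ofRealHom.mapMatrix (bloch (G i)) * Y) := fun i Y => by
    rw [← Matrix.mul_assoc, liouville_mul_tracelessInclusion (hG i), Matrix.mul_assoc]
  rw [twirlingSuperchannel_mulVec_vec, twirl_apply, Matrix.mul_assoc (tracelessInclusion * W),
    transpose_tracelessInclusion_mul_self, Matrix.mul_one]
  simp only [Matrix.mul_smul, Matrix.smul_mul, Matrix.mul_sum, Matrix.sum_mul, Matrix.mul_assoc,
    hterm]

theorem mem_spectrum_twirlingSuperchannel (hG : ∀ i, IsHermitianTP (G i))
    {W : Matrix (Fin 3) (Fin 3) ℂ} (hW0 : W ≠ 0)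
    (hW : twirl (fun i => Complex.ofRealHom.mapMatrix (bloch (G i)))
      (fun i => Complex.ofRealHom.mapMatrix (rotation (u i))) W = z • W) :
    z ∈ spectrum ℂ (twirlingSuperchannel G (idealGates u)) := by
  refine (mem_spectrum_iff_exists_mulVec _ _).2
    ⟨(tracelessInclusion * W * tracelessInclusionᵀ).vec, fun h => hW0 ?_, ?_⟩
  · refine injective_tracelessInclusion_mul_mul_transpose ?_
    simpa only [Matrix.mul_zero, Matrix.zero_mul] using Matrix.vec_eq_zero_iff.1 h
  · rw [twirlingSuperchannel_mulVec_vec_tracelessInclusion hG, hW, Matrix.mul_smul,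
      Matrix.smul_mul, Matrix.vec_smul]

theorem apply_zero_of_twirlingSuperchannel_mulVec_vec (hG : ∀ i, IsHermitianTP (G i))
    (hu : ∑ i, rotation (u i) = 0) (hz0 : z ≠ 0) {X : Matrix (Fin 4) (Fin 4) ℂ}
    (hX : twirlingSuperchannel G (idealGates u) *ᵥ X.vec = z • X.vec) (k : Fin 4) :
    X 0 k = 0 := by
  have hsum : ∑ i, (Complex.ofRealHom.mapMatrix (rotation (u i)))ᴴ = 0 := by
    rw [← Matrix.conjTranspose_sum, ← map_sum, hu, map_zero, Matrix.conjTranspose_zero]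
  rw [twirlingSuperchannel_mulVec_vec, ← Matrix.vec_smul, Matrix.vec_inj] at hX
  have h := congrFun (congrFun hX 0) k
  simp only [Matrix.smul_apply, Matrix.sum_apply, liouville_mul_apply_zero (hG _)] at h
  rw [← Matrix.sum_apply, ← Matrix.sum_mul, ← Matrix.mul_sum, hsum, Matrix.mul_zero,
    Matrix.zero_mul, Matrix.zero_apply, smul_zero, eq_comm] at h
  exact (smul_eq_zero.1 h).resolve_left hz0

theorem exists_twirl_eq_smul_of_mem_spectrum (hG : ∀ i, IsHermitianTP (G i))
    (hu : ∑ i, rotation (u i) = 0) (hz0 : z ≠ 0)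
    (hz : z ∈ spectrum ℂ (twirlingSuperchannel G (idealGates u))) :
    ∃ W ≠ 0, twirl (fun i => Complex.ofRealHom.mapMatrix (bloch (G i)))
      (fun i => Complex.ofRealHom.mapMatrix (rotation (u i))) W = z • W := by
  obtain ⟨w, hw0, hw⟩ := (mem_spectrum_iff_exists_mulVec _ _).1 hz
  obtain ⟨X, rfl⟩ := Matrix.vec_bijective.surjective w
  have hrow := apply_zero_of_twirlingSuperchannel_mulVec_vec hG hu hz0 hw
  have hcol : X * tracelessInclusion * tracelessInclusionᵀ = X := by
    have h := hw
    rw [twirlingSuperchannel_mulVec_vec, ← Matrix.vec_smul, Matrix.vec_inj,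
      eq_comm, ← eq_inv_smul_iff₀ hz0] at h
    rw [h]
    simp only [Matrix.smul_mul, Matrix.sum_mul, Matrix.mul_assoc]
    simp only [← Matrix.mul_assoc tracelessInclusionᵀ, transpose_tracelessInclusion_mul_self,
      Matrix.one_mul]
  have hX : tracelessInclusion * (tracelessInclusionᵀ * X * tracelessInclusion)
      * tracelessInclusionᵀ = X := by
    rw [Matrix.mul_assoc tracelessInclusionᵀ, Matrix.mul_assoc, Matrix.mul_assoc, hcol,
      tracelessInclusion_mul_transpose_mul hrow]
  refine ⟨tracelessInclusionᵀ * X * tracelessInclusion, fun h => hw0 ?_, ?_⟩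
  · rw [← hX, h, Matrix.mul_zero, Matrix.zero_mul, Matrix.vec_zero]
  · refine injective_tracelessInclusion_mul_mul_transpose (Matrix.vec_inj.1 ?_)
    dsimp only
    rw [← twirlingSuperchannel_mulVec_vec_tracelessInclusion hG, hX, hw, Matrix.mul_smul,
      Matrix.smul_mul, hX, Matrix.vec_smul]

end Superchannel

section Alignment

theorem compactSpace_unitaryGroup (n 𝕜 : Type*) [Fintype n] [DecidableEq n] [RCLike 𝕜] :
    CompactSpace (Matrix.unitaryGroup n 𝕜) := by
  have hbox : IsCompact (Set.univ.pi fun _ : n => Set.univ.pi fun _ : n =>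
      Metric.closedBall (0 : 𝕜) 1) :=
    isCompact_univ_pi fun _ => isCompact_univ_pi fun _ => isCompact_closedBall _ _
  have hclosed : IsClosed {X : Matrix n n 𝕜 | X ∈ Matrix.unitaryGroup n 𝕜} := by
    simp only [Matrix.mem_unitaryGroup_iff]
    exact isClosed_eq (by fun_prop) continuous_const
  exact isCompact_iff_compactSpace.1 (hbox.of_isClosed_subset hclosed fun X hX i _ j _ =>
    mem_closedBall_zero_iff.2 (entry_norm_bound_of_unitary hX i j))

theorem continuous_rotation : Continuous rotation := by
  refine continuous_matrix fun j k => ?_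
  simp only [rotation, bloch, blochVec, hsInner, Matrix.of_apply, unitaryChannel_apply]
  fun_prop

theorem eq_zero_of_forall_cos_mul_add_sin_mul_le {a b : ℝ}
    (h : ∀ θ, Real.cos θ * a + Real.sin θ * b ≤ a) : b = 0 := by
  have hmax : IsLocalMax (fun θ => Real.cos θ * a + Real.sin θ * b) 0 :=
    Filter.Eventually.of_forall fun θ => by simpa using h θ
  have hderiv : HasDerivAt (fun θ => Real.cos θ * a + Real.sin θ * b)
      (-Real.sin 0 * a + Real.cos 0 * b) 0 :=
    ((Real.hasDerivAt_cos 0).mul_const a).add ((Real.hasDerivAt_sin 0).mul_const b)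
  simpa using hmax.hasDerivAt_eq_zero hderiv

theorem trace_mul_conjTranspose_crossProduct (B : Matrix (Fin 3) (Fin 3) ℝ) (r : Fin 3 → ℝ) :
    (B * ((crossProduct r).toMatrix')ᴴ).trace
      = r ⬝ᵥ ![B 2 1 - B 1 2, B 0 2 - B 2 0, B 1 0 - B 0 1] := by
  simp [Matrix.trace, Matrix.mul_apply, dotProduct, Fin.sum_univ_three, LinearMap.toMatrix'_apply,
    cross_apply]
  ring

theorem isHermitian_of_forall_trace_mul_rotation_le {B : Matrix (Fin 3) (Fin 3) ℝ}
    (hB : ∀ w, (B * (rotation w)ᴴ).trace ≤ B.trace) : B.IsHermitian := by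
  have hcross : ∀ r : Fin 3 → ℝ, r ⬝ᵥ r = 1 →
      r ⬝ᵥ ![B 2 1 - B 1 2, B 0 2 - B 2 0, B 1 0 - B 0 1] = 0 := fun r hr => by
    rw [← trace_mul_conjTranspose_crossProduct]
    refine eq_zero_of_forall_cos_mul_add_sin_mul_le
      (a := B.trace - (B * (Matrix.vecMulVec r r)ᴴ).trace) fun θ => ?_
    have h := hB (axisUnitary hr θ)
    simp only [rotation_axisUnitary, Matrix.conjTranspose_add, Matrix.conjTranspose_smul,
      Matrix.conjTranspose_one, star_trivial, mul_add, mul_smul_comm, mul_one, Matrix.trace_add,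
      Matrix.trace_smul, smul_eq_mul] at h
    linarith
  have h21 : B 2 1 = B 1 2 :=
    sub_eq_zero.1 (by simpa using hcross ![1, 0, 0] (by simp))
  have h02 : B 0 2 = B 2 0 :=
    sub_eq_zero.1 (by simpa using hcross ![0, 1, 0] (by simp))
  have h10 : B 1 0 = B 0 1 :=
    sub_eq_zero.1 (by simpa using hcross ![0, 0, 1] (by simp))
  ext i j
  fin_cases i <;> fin_cases j <;> simp [*]

theorem exists_isHermitian_mul_rotation (A : Matrix (Fin 3) (Fin 3) ℝ) :
    ∃ v, (A * (rotation v)ᴴ).IsHermitian ∧ A.trace ≤ (A * (rotation v)ᴴ).trace := by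
  have := compactSpace_unitaryGroup (Fin 2) ℂ
  have hcont : Continuous fun v => (A * (rotation v)ᴴ).trace :=
    (continuous_const.matrix_mul continuous_rotation.matrix_conjTranspose).matrix_trace
  obtain ⟨v, -, hv⟩ := isCompact_univ.exists_isMaxOn Set.univ_nonempty hcont.continuousOn
  refine ⟨v, isHermitian_of_forall_trace_mul_rotation_le fun w => ?_, ?_⟩
  · have h : (A * (rotation (w * v))ᴴ).trace ≤ (A * (rotation v)ᴴ).trace :=
      hv (Set.mem_univ (w * v))
    rwa [rotation_mul, Matrix.conjTranspose_mul, ← mul_assoc] at h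
  · have h : (A * (rotation 1)ᴴ).trace ≤ (A * (rotation v)ᴴ).trace := hv (Set.mem_univ 1)
    rwa [rotation_one, Matrix.conjTranspose_one, mul_one] at h

end Alignment

section DecayParameter

variable {ι : Type*} {G : ι → SuperOp} {u : ι → Matrix.unitaryGroup (Fin 2) ℂ}
  {p : ℝ} {A : Matrix (Fin 3) (Fin 3) ℝ}

theorem rotate_idealGates (v : Matrix.unitaryGroup (Fin 2) ℂ)
    (u : ι → Matrix.unitaryGroup (Fin 2) ℂ) :
    rotate v (idealGates u) = idealGates fun i => v * u i * v⁻¹ := by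
  funext i
  rw [rotate, idealGates, idealGates, unitaryChannel_mul, unitaryChannel_mul]

variable [Fintype ι]

theorem isRBDecayParameter_of_dominant (hG : ∀ i, IsHermitianTP (G i))
    (hu : ∑ i, rotation (u i) = 0) (hp : 0 ≤ p) (hA0 : A ≠ 0)
    (hA : twirl (fun i => bloch (G i)) (fun i => rotation (u i)) A = p • A)
    (hdom : ∀ (z : ℂ) (W : Matrix (Fin 3) (Fin 3) ℂ), W ≠ 0 →
      twirl (fun i => Complex.ofRealHom.mapMatrix (bloch (G i)))
        (fun i => Complex.ofRealHom.mapMatrix (rotation (u i))) W = z • W → ‖z‖ ≤ p) :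
    IsRBDecayParameter G (idealGates u) p := by
  refine ⟨mem_spectrum_twirlingSuperchannel hG (W := Complex.ofRealHom.mapMatrix A) ?_ ?_,
    fun z hz => ?_⟩
  · exact fun h => hA0 (Matrix.map_injective Complex.ofReal_injective (h.trans
      (map_zero Complex.ofRealHom.mapMatrix).symm))
  · rw [twirl_mapMatrix_ofReal, hA, mapMatrix_ofReal_smul]
  · obtain rfl | hz0 := eq_or_ne z 0
    · rwa [norm_zero]
    · obtain ⟨W, hW0, hW⟩ := exists_twirl_eq_smul_of_mem_spectrum hG hu hz0 hz
      exact hdom z W hW0 hW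

variable [Nonempty ι]

theorem card_sub_trace_twirl_rotation_one (hG : ∀ i, IsHermitianTP (G i))
    (u : ι → Matrix.unitaryGroup (Fin 2) ℂ) :
    Fintype.card (Fin 3) - (twirl (fun i => bloch (G i)) (fun i => rotation (u i)) 1).trace
      = 6 * (1 - gateSetFidelity G (idealGates u) 1) := by
  rw [gateSetFidelity_idealGates hG, pow_one, normalizedTrace_apply, Fintype.card_fin]
  push_cast
  ring

open scoped Matrix.Norms.Frobenius in
theorem exists_isRBDecayParameter (hG : ∀ i, IsPositiveTP (G i)) (hu : IsTwoDesign u)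
    (hF : 1 - gateSetFidelity G (idealGates u) 1 ≤ 1 / 10 ^ 8) :
    ∃ (p : ℝ) (A : Matrix (Fin 3) (Fin 3) ℝ), IsRBDecayParameter G (idealGates u) p ∧
      twirl (fun i => bloch (G i)) (fun i => rotation (u i)) A = p • A ∧
      normalizedTrace ℝ (Fin 3) A = 1 ∧ ‖A - 1‖ ≤ 1 / 2 ∧ |p - 1| ≤ 1 / 500 := by
  have hG' := fun i => (hG i).isHermitianTP
  obtain ⟨p, A, hA, hτ, hA1, hp, hdom⟩ := exists_dominant_eigenpair_twirl
    (fun i => (hG i).isContraction_bloch) hu.isDepolarizing_rotation (δ := 1 / 1000)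
    (by norm_num) (by norm_num) (by rw [card_sub_trace_twirl_rotation_one hG']; linarith)
  have hp0 : 0 ≤ p := by linarith [(abs_le.1 hp).1]
  have hA0 : A ≠ 0 := by rintro rfl; simp only [map_zero, zero_ne_one] at hτ
  refine ⟨p, A, isRBDecayParameter_of_dominant hG' hu.sum_rotation hp0 hA0 hA hdom, hA, hτ,
    hA1.trans ?_, by linarith⟩
  rw [Fintype.card_fin]
  linarith [Real.sqrt_le_left (x := 3) (y := 2) (by norm_num) |>.2 (by norm_num)]

open scoped Matrix.Norms.Frobenius in
theorem exists_abs_gateSetFidelity_rotate_sub_le (hG : ∀ i, IsPositiveTP (G i))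
    (hu : IsTwoDesign u) (hA : twirl (fun i => bloch (G i)) (fun i => rotation (u i)) A = p • A)
    (hτ : normalizedTrace ℝ (Fin 3) A = 1) (hA1 : ‖A - 1‖ ≤ 1 / 2) (hp : 432 * (1 - p) ≤ 1) :
    ∃ v, ∀ m, |gateSetFidelity G (rotate v (idealGates u)) m - (1 / 2 + (2 - 1) / 2 * p ^ m)|
      ≤ 234 * (1 - p) ^ 2 := by
  obtain ⟨v, hAv, htr⟩ := exists_isHermitian_mul_rotation A
  refine ⟨v, fun m => ?_⟩
  have hbound := abs_normalizedTrace_twirl_conj_pow_sub_le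
    (fun i => (hG i).isContraction_bloch) hu.isDepolarizing_rotation hA hτ hA1
    (by rw [Fintype.card_fin]; push_cast; linarith) (rotation_conjTranspose_mul_self v) hAv htr m
  rw [Fintype.card_fin] at hbound
  rw [rotate_idealGates, gateSetFidelity_idealGates fun i => (hG i).isHermitianTP]
  simp only [rotation_mul, rotation_inv]
  rw [show ∀ x : ℝ, 1 / 2 + x / 2 - (1 / 2 + (2 - 1) / 2 * p ^ m) = (x - p ^ m) / 2 by
    intro x; ring, abs_div, abs_two]
  push_cast at hbound
  linarith

end DecayParameter

end QubitRB

theorem proposition1_general :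
    ∃ ε : ℝ, 0 < ε ∧ ∃ K : ℝ, 0 < K ∧
      ∀ (ι : Type*) [Fintype ι] [Nonempty ι] (u : ι → Matrix.unitaryGroup (Fin 2) ℂ)
        (Gn : ι → QubitRB.SuperOp),
        QubitRB.IsTwoDesign u →
        (∀ i, QubitRB.IsPositiveTP (Gn i)) →
        1 - QubitRB.gateSetFidelity Gn (QubitRB.idealGates u) 1 ≤ ε →
        ∃ p : ℝ, QubitRB.IsRBDecayParameter Gn (QubitRB.idealGates u) p ∧
          ∃ v : Matrix.unitaryGroup (Fin 2) ℂ, ∀ m : ℕ,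
            |QubitRB.gateSetFidelity Gn (QubitRB.rotate v (QubitRB.idealGates u)) m
                - (1 / 2 + (2 - 1) / 2 * p ^ m)| ≤ K * (1 - p) ^ 2 := by
  refine ⟨1 / 10 ^ 8, by norm_num, 234, by norm_num, fun ι _ _ u Gn hu hG hF => ?_⟩
  obtain ⟨p, A, hp, hA, hτ, hA1, hp1⟩ := QubitRB.exists_isRBDecayParameter hG hu hF
  exact ⟨p, hp, QubitRB.exists_abs_gateSetFidelity_rotate_sub_le hG hu hA hτ hA1
    (by linarith [(abs_le.1 hp1).1])⟩

theorem proposition1 :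
    ∃ ε : ℝ, 0 < ε ∧ ∃ K : ℝ, 0 < K ∧
      ∀ (ι : Type*) [Fintype ι] [Nonempty ι] (u : ι → Matrix.unitaryGroup (Fin 2) ℂ)
        (Gn : ι → QubitRB.SuperOp),
        QubitRB.IsTwoDesign u →
        (∀ i, QubitRB.IsChannel (Gn i)) →
        1 - QubitRB.gateSetFidelity Gn (QubitRB.idealGates u) 1 ≤ ε →
        ∃ p : ℝ, QubitRB.IsRBDecayParameter Gn (QubitRB.idealGates u) p ∧
          ∃ v : Matrix.unitaryGroup (Fin 2) ℂ, ∀ m : ℕ,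
            |QubitRB.gateSetFidelity Gn (QubitRB.rotate v (QubitRB.idealGates u)) m
                - (1 / 2 + (2 - 1) / 2 * p ^ m)| ≤ K * (1 - p) ^ 2 :=
  have ⟨ε, hε, K, hK, h⟩ := proposition1_general
  ⟨ε, hε, K, hK, fun ι _ _ u Gn hu hG => h ι u Gn hu fun i => (hG i).isPositiveTP⟩
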